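/- Let $\mathscr H\neq 0$ be a complex Hilbert space with canonical observables $q=(x_1,\dots,x_s,p_1,\dots,p_s)$, i.e. symmetric operators with a common dense invariant domain $D$ on which $[x_i,x_j]=[p_i,p_j]=0$ and $[x_i,p_j]=i\delta_{ij}$. Let $H(t)=\sum_{i,j=1}^{2s}h_{ij}(t)q_iq_j$, where $h(t)$ is a real symmetric matrix, piecewise continuous and $T$-periodic in $t$ ($T>0$). By an evolution of a Hamiltonian we mean unitary operators $U(t,\tau)$ ($t,\tau\in\mathbb R$) with $U(\tau,\tau)=1$, $U(t,\tau)U(\tau,\sigma)=U(t,\sigma)$, $U(t,\tau)D\subset D$, such that for $\psi\in D$ the vectors $U(t,\tau)\psi$ and $q_iU(t,\tau)\psi$ are continuous in $t$ and $\frac{d}{dt}U(t,\tau)\psi=-iH(t)U(t,\tau)\psi$ wherever $h$ is continuous; then $A(t)=U(t,0)^\dagger AU(t,0)$ denotes the Heisenberg observable of $A$. Let $U$ be an evolution of $H(t)$ which forms a loop: $U(T,0)=e^{i\varphi}1$, $\varphi\in\mathbb R$. Then the following holds on $D$. The loop center $X=(X_1,\dots,X_s)$, $X_j=\frac1T\int_\tau^{\tau+T}x_j(t)\,dt$,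 exists, does not depend on $\tau$, is a real linear combination of $q_1,\dots,q_{2s}$, and $[X_k,X_l]=i\kappa_{kl}$ with real numbers $\kappa_{kl}$. Let $F\in\mathbb R^s$ be a constant force, and let $\tilde U$ be an evolution of $\tilde H(t)=H(t)-\sum_jF_jx_j$, with Heisenberg observables $\tilde A(t)=\tilde U(t,0)^\dagger A\tilde U(t,0)$. Put $v_k=\sum_l\kappa_{lk}F_l=-\sum_l\kappa_{kl}F_l$ and $\tilde X_k(\tau)=\frac1T\int_\tau^{\tau+T}\tilde x_k(t)\,dt$ (which exists). Then, for $n=0,1,2,\dots$: (0) the displacement of the canonical observables over $n$ periods is determined by $X$: $\tilde q_i(nT)=q_i-inT\,[\sum_lF_lX_l,\,q_i]$. (1) The center drifts with the constant velocity $v$, orthogonal to $F$: $\tilde U(nT,0)^\dagger X_k\tilde U(nT,0)=X_k+nT\,v_k$ and $\tilde X_k(\tau+nT)=\tilde X_k(\tau)+nT\,v_k$ for all $\tau$, and $\sum_kF_kv_k=0$. If the coordinates of $X$ do not all commute, then $v\ne0$ for some $F$. (2) If $[X_k,X_l]=0$ for all $k,l$, then the center does not drift: $\tilde U(nT,0)^\dagger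 X_k\tilde U(nT,0)=X_k$ and $\tilde X_k(\tau+nT)=\tilde X_k(\tau)$. (3) If $X_k=0$ for all $k$, then the loop remains closed and stable: $\tilde q_i(t+T)=\tilde q_i(t)$ for all $t$ and $i$, and, if the canonical observables are irreducible (every bounded operator on $\mathscr H$ that maps $D$ into $D$ and commutes with all $q_i$ on $D$ is a number), there is $\chi\in\mathbb R$ with $\tilde U(t+T,t)=e^{i\chi}1$ for all $t$. For $F\neq0$ the loop of the canonical observables is deformed: $\tilde q_i(t)\ne q_i(t)$ for some $i$ and some $t\in(0,T)$. -/

import Mathlib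

open Filter Topology
open scoped Matrix

/-- A system of `s` pairs of canonical observables in a Hilbert space `𝓗`: symmetric operators
`x 1, …, x s, p 1, …, p s` with a common dense invariant domain, on which they satisfy the
canonical commutation relations (with `ℏ = 1`). -/
structure CanonicalObservables (s : ℕ) (𝓗 : Type*) [NormedAddCommGroup 𝓗]
    [InnerProductSpace ℂ 𝓗] where
  /-- the common invariant domain -/
  domain : Submodule ℂ 𝓗
  dense : Dense (domain : Set 𝓗)
  /-- the positions -/
  x : Fin s → Module.End ℂ domain
  /-- the momenta -/
  p : Fin s → Module.End ℂ domain
  x_symm : ∀ (j : Fin s) (φ ψ : domain), inner ℂ (x j φ : 𝓗) (ψ : 𝓗) = inner ℂ (φ : 𝓗) (x j ψ : 𝓗)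
  p_symm : ∀ (j : Fin s) (φ ψ : domain), inner ℂ (p j φ : 𝓗) (ψ : 𝓗) = inner ℂ (φ : 𝓗) (p j ψ : 𝓗)
  comm_xx : ∀ i j : Fin s, ⁅x i, x j⁆ = 0
  comm_pp : ∀ i j : Fin s, ⁅p i, p j⁆ = 0
  comm_xp : ∀ i j : Fin s, ⁅x i, p j⁆ = if i = j then Complex.I • 1 else 0

/-- The times at which a matrix-valued function of time is discontinuous. -/
def jumpTimes {ι : Type*} (h : ℝ → Matrix ι ι ℝ) : Set ℝ := {t | ¬ ContinuousAt h t}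

/-- Piecewise continuity: finitely many discontinuities in each bounded interval, and one-sided
limits everywhere. -/
def IsPiecewiseContinuous {ι : Type*} (h : ℝ → Matrix ι ι ℝ) : Prop :=
  (∀ a b : ℝ, (jumpTimes h ∩ Set.Icc a b).Finite) ∧
    ∀ t : ℝ, (∃ l, Tendsto h (𝓝[<] t) (𝓝 l)) ∧ ∃ r, Tendsto h (𝓝[>] t) (𝓝 r)

namespace CanonicalObservables

variable {s : ℕ} {𝓗 : Type*} [NormedAddCommGroup 𝓗] [InnerProductSpace ℂ 𝓗]

/-- The column `q = (x, p)` of all `2s` canonical observables. -/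
def q (Q : CanonicalObservables s 𝓗) : Fin s ⊕ Fin s → Module.End ℂ Q.domain :=
  Sum.elim Q.x Q.p

/-- The quadratic form `∑ i j, h i j • q i q j` in the canonical observables. -/
noncomputable def quadratic (Q : CanonicalObservables s 𝓗)
    (h : Matrix (Fin s ⊕ Fin s) (Fin s ⊕ Fin s) ℝ) : Module.End ℂ Q.domain :=
  ∑ i, ∑ j, (h i j : ℂ) • (Q.q i * Q.q j)

/-- The scalar product `F · A = ∑ j, F j • A j` of a numerical vector and a vector of operators. -/
noncomputable def dot (Q : CanonicalObservables s 𝓗) (F : Fin s → ℝ)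
    (A : Fin s → Module.End ℂ Q.domain) : Module.End ℂ Q.domain :=
  ∑ j, (F j : ℂ) • A j

/-- The canonical observables are irreducible: a bounded operator (preserving the domain) which
commutes with all of them is a number. -/
def Irreducible (Q : CanonicalObservables s 𝓗) : Prop :=
  ∀ (A : 𝓗 →L[ℂ] 𝓗) (hA : ∀ ψ : Q.domain, A (ψ : 𝓗) ∈ Q.domain),
    (∀ (i : Fin s ⊕ Fin s) (ψ : Q.domain), A (Q.q i ψ : 𝓗) = (Q.q i ⟨A (ψ : 𝓗), hA ψ⟩ : 𝓗)) →
      ∃ c : ℂ, ∀ ψ : 𝓗, A ψ = c • ψ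

/-- The unitary evolution operators `U t τ` of a time dependent Hamiltonian `H`: a family of
unitary operators with `U τ τ = 1`, `U t τ * U τ σ = U t σ`, which preserves the domain of the
canonical observables and solves `d/dt U t τ = -i H t U t τ` strongly on it for all `t` outside
the set `B` of the times where `H` jumps. The vectors `U t τ ψ` and `q i (U t τ ψ)`, with `ψ` in
the domain, are continuous in `t` at all times. -/
structure Evolution (Q : CanonicalObservables s 𝓗) (H : ℝ → Module.End ℂ Q.domain)
    (B : Set ℝ) where
  U : ℝ → ℝ → (𝓗 ≃ₗᵢ[ℂ] 𝓗)
  U_self : ∀ τ, U τ τ = 1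
  U_mul : ∀ t τ σ, U t τ * U τ σ = U t σ
  U_mem : ∀ (t τ : ℝ) (ψ : Q.domain), U t τ (ψ : 𝓗) ∈ Q.domain
  continuous_U : ∀ (τ : ℝ) (ψ : Q.domain), Continuous fun t => U t τ (ψ : 𝓗)
  continuous_qU : ∀ (τ : ℝ) (i : Fin s ⊕ Fin s) (ψ : Q.domain),
    Continuous fun t => (Q.q i ⟨U t τ (ψ : 𝓗), U_mem t τ ψ⟩ : 𝓗)
  hasDerivAt_U : ∀ (t τ : ℝ) (ψ : Q.domain), t ∉ B →
    HasDerivAt (fun r => U r τ (ψ : 𝓗))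
      (-Complex.I • (H t ⟨U t τ (ψ : 𝓗), U_mem t τ ψ⟩ : 𝓗)) t

namespace Evolution

variable {Q : CanonicalObservables s 𝓗} {H : ℝ → Module.End ℂ Q.domain} {B : Set ℝ}

/-- The evolution operator `U t τ` restricted to the domain. -/
def onDomain (E : Q.Evolution H B) (t τ : ℝ) : Module.End ℂ Q.domain :=
  (E.U t τ).toLinearEquiv.toLinearMap.restrict fun ψ hψ => E.U_mem t τ ⟨ψ, hψ⟩

/-- The Heisenberg observable `A(t) = U(t,0)† A U(t,0)`; note `U(t,0)† = U(t,0)⁻¹ = U(0,t)`. -/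
def heisenberg (E : Q.Evolution H B) (A : Module.End ℂ Q.domain) (t : ℝ) :
    Module.End ℂ Q.domain :=
  E.onDomain 0 t * A * E.onDomain t 0

theorem inv_U (E : Q.Evolution H B) (t : ℝ) : (E.U t 0)⁻¹ = E.U 0 t := by
  rw [inv_eq_iff_mul_eq_one, E.U_mul, E.U_self]

/-- `A(t) ψ = U(t,0)⁻¹ A U(t,0) ψ` for `ψ` in the domain. -/
theorem coe_heisenberg (E : Q.Evolution H B) (A : Module.End ℂ Q.domain) (t : ℝ)
    (ψ : Q.domain) : (E.heisenberg A t ψ : 𝓗)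
      = (E.U t 0)⁻¹ (A ⟨E.U t 0 (ψ : 𝓗), E.U_mem t 0 ψ⟩ : 𝓗) := by
  rw [E.inv_U]; rfl

/-- The operator `M` is the time average `(1/T) ∫ A(t) dt` of the Heisenberg observable `A(t)` over
the interval `[τ, τ + T]` (a convergent integral on each vector of the domain). -/
def IsTimeAverage (E : Q.Evolution H B) (A : Module.End ℂ Q.domain) (T τ : ℝ)
    (M : Module.End ℂ Q.domain) : Prop :=
  ∀ ψ : Q.domain,
    IntervalIntegrable (fun t => (E.heisenberg A t ψ : 𝓗)) MeasureTheory.volume τ (τ + T) ∧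
      (M ψ : 𝓗) = T⁻¹ • ∫ t in τ..(τ + T), (E.heisenberg A t ψ : 𝓗)

end Evolution

end CanonicalObservables

/-- The drift velocity `v k = ∑ l, κ l k * F l` caused by the force `F`. -/
def driftVelocity {s : ℕ} (κ : Matrix (Fin s) (Fin s) ℝ) (F : Fin s → ℝ) : Fin s → ℝ :=
  fun k => ∑ l, κ l k * F l

/-! The Heisenberg equations of a quadratic Hamiltonian are linear with real coefficients, `q' =
i[H, q] = 2Ωh q`. Hence `q(t) = M(t) q` with a real matrix `M` that preserves `Ω` and so is
invertible. A loop has `U(t+T,0) = U(t,0) U(T,0)` with `U(T,0)` a phase; the phase cancels in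
`q(t)`. Since the `q_i` are linearly independent, `M` is `T`-periodic. The center is then `X = u q`,
where `u` averages the position rows of `M`, and `κ = u Ω uᵀ`.

A constant force adds only the numerical inhomogeneity `fΩ`, with `f = (F, 0)`. Variation of
constants gives `q̃(t) = M(t) q - M(t) Ω G(t)`, where `G(t) = ∫₀ᵗ f M` (`solution_eq`,
`hasForcedTrajectory`). By periodicity `G` grows by `T • F u` in each period
(`forceIntegral_add_nat_mul`), and every claim about the drift follows from this: `M(nT) = 1` gives
the displacement `-nT Ω(F u)`, and contraction with `u` gives the drift of `X`. If `X = 0`, then `u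
= 0`, and `G` and the trajectory are periodic. If the force left the loop unchanged, then `G`, hence
`f M` and `F`, would vanish.

The operators are unbounded, so the differential equations are written for matrix elements `⟪φ,
q_i(t) ψ⟫` only. These also supply `M` (`exists_isFundamentalMatrix`): combinations of them realize
all initial values. The conserved symplectic pairing (`symplectic_pairing`) takes the place of a
uniqueness theorem and yields the inverse of `M`. -/

/-- The matrix `Ω` of the canonical commutation relations `[q i, q j] = i Ω i j`. -/
def symplecticForm (s : ℕ) : Matrix (Fin s ⊕ Fin s) (Fin s ⊕ Fin s) ℝ :=
  Matrix.fromBlocks 0 1 (-1) 0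

theorem symplecticForm_transpose (s : ℕ) : (symplecticForm s)ᵀ = -symplecticForm s := by
  simp [symplecticForm, Matrix.fromBlocks_transpose, Matrix.fromBlocks_neg]

theorem symplecticForm_mul_self (s : ℕ) : symplecticForm s * symplecticForm s = -1 := by
  rw [symplecticForm, Matrix.fromBlocks_multiply]
  simp [← Matrix.fromBlocks_one, Matrix.fromBlocks_neg]

theorem symplecticForm_swap {s : ℕ} (i j : Fin s ⊕ Fin s) :
    symplecticForm s i j = -symplecticForm s j i := by
  simpa using congrFun (congrFun (symplecticForm_transpose s) j) i

theorem jumpTimes_countable {ι : Type*} {h : ℝ → Matrix ι ι ℝ} (hc : IsPiecewiseContinuous h) :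
    (jumpTimes h).Countable := by
  have : jumpTimes h = ⋃ n : ℕ, jumpTimes h ∩ Set.Icc (-(n : ℝ)) n := by
    ext t
    simp only [Set.mem_iUnion, Set.mem_inter_iff, exists_and_left, iff_self_and, Set.mem_Icc]
    intro _
    obtain ⟨n, hn⟩ := exists_nat_ge |t|
    exact ⟨n, abs_le.mp hn⟩
  rw [this]
  exact Set.countable_iUnion fun n => (hc.1 _ _).countable

theorem add_mem_jumpTimes {ι : Type*} {h : ℝ → Matrix ι ι ℝ} {T t : ℝ}
    (hp : Function.Periodic h T) : t + T ∈ jumpTimes h ↔ t ∈ jumpTimes h := by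
  have h1 : (h ∘ fun r => r + T) = h := funext hp
  have h2 : ContinuousAt (h ∘ fun r => r + T) t ↔ ContinuousAt h (t + T) :=
    (Homeomorph.addRight T).comp_continuousAt_iff' h t
  rw [h1] at h2
  exact not_congr h2.symm

/-! ### Symmetry and commutator algebra of the canonical observables -/

namespace CanonicalObservables

variable {s : ℕ} {𝓗 : Type*} [NormedAddCommGroup 𝓗] [InnerProductSpace ℂ 𝓗]

/-- The operator `A` is symmetric on the domain: `⟪A φ, ψ⟫ = ⟪φ, A ψ⟫`. -/
def IsSymmetricOp (Q : CanonicalObservables s 𝓗) (A : Module.End ℂ Q.domain) : Prop :=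
  ∀ φ ψ : Q.domain, inner ℂ (A φ : 𝓗) (ψ : 𝓗) = inner ℂ (φ : 𝓗) (A ψ : 𝓗)

theorem q_symm (Q : CanonicalObservables s 𝓗) (i : Fin s ⊕ Fin s) : Q.IsSymmetricOp (Q.q i) := by
  rcases i with i | i
  · exact Q.x_symm i
  · exact Q.p_symm i

theorem quadratic_symm (Q : CanonicalObservables s 𝓗)
    {h : Matrix (Fin s ⊕ Fin s) (Fin s ⊕ Fin s) ℝ} (hs : h.IsSymm) :
    Q.IsSymmetricOp (Q.quadratic h) := by
  intro φ ψ
  simp only [quadratic, LinearMap.sum_apply, LinearMap.smul_apply, Module.End.mul_apply,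
    Submodule.coe_sum, Submodule.coe_smul, sum_inner, inner_sum, inner_smul_left, inner_smul_right,
    Complex.conj_ofReal]
  rw [Finset.sum_comm]
  refine Finset.sum_congr rfl fun i _ => Finset.sum_congr rfl fun j _ => ?_
  rw [Q.q_symm, Q.q_symm, hs.apply]

theorem dot_symm (Q : CanonicalObservables s 𝓗) (F : Fin s → ℝ) :
    Q.IsSymmetricOp (Q.dot F Q.x) := by
  intro φ ψ
  simp only [dot, LinearMap.sum_apply, LinearMap.smul_apply, Submodule.coe_sum,
    Submodule.coe_smul, sum_inner, inner_sum, inner_smul_left, inner_smul_right,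
    Complex.conj_ofReal, Q.x_symm]

theorem IsSymmetricOp.sub {Q : CanonicalObservables s 𝓗} {A B : Module.End ℂ Q.domain}
    (hA : Q.IsSymmetricOp A) (hB : Q.IsSymmetricOp B) : Q.IsSymmetricOp (A - B) := by
  intro φ ψ
  rw [LinearMap.sub_apply, LinearMap.sub_apply, Submodule.coe_sub, Submodule.coe_sub,
    inner_sub_left, inner_sub_right, hA φ ψ, hB φ ψ]

theorem sum_smul_lie {V ι : Type*} [AddCommGroup V] [Module ℂ V] [Fintype ι] (c : ι → ℂ)
    (A : ι → Module.End ℂ V) (B : Module.End ℂ V) :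
    ⁅∑ i, c i • A i, B⁆ = ∑ i, c i • ⁅A i, B⁆ := by
  simp only [Ring.lie_def, Finset.sum_mul, Finset.mul_sum, smul_sub, Finset.sum_sub_distrib,
    smul_mul_assoc, mul_smul_comm]

theorem lie_sum_smul {V ι : Type*} [AddCommGroup V] [Module ℂ V] [Fintype ι] (c : ι → ℂ)
    (A : ι → Module.End ℂ V) (B : Module.End ℂ V) :
    ⁅B, ∑ i, c i • A i⁆ = ∑ i, c i • ⁅B, A i⁆ := by
  simp only [Ring.lie_def, Finset.sum_mul, Finset.mul_sum, smul_sub, Finset.sum_sub_distrib,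
    smul_mul_assoc, mul_smul_comm]

theorem lie_q (Q : CanonicalObservables s 𝓗) (i j : Fin s ⊕ Fin s) :
    ⁅Q.q i, Q.q j⁆ = (Complex.I * (symplecticForm s i j : ℂ)) • (1 : Module.End ℂ Q.domain) := by
  rcases i with i | i <;> rcases j with j | j
  · simp [q, symplecticForm, Q.comm_xx]
  · simp only [q, Sum.elim_inl, Sum.elim_inr, Q.comm_xp, symplecticForm,
      Matrix.fromBlocks_apply₁₂, Matrix.one_apply]
    split_ifs <;> simp
  · have := Q.comm_xp j i
    rw [Ring.lie_def, ← neg_inj, neg_sub] at this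
    simp only [q, Sum.elim_inl, Sum.elim_inr, Ring.lie_def, this, symplecticForm,
      Matrix.fromBlocks_apply₂₁, Matrix.neg_apply, Matrix.one_apply, eq_comm (a := j)]
    split_ifs
    · rw [Complex.ofReal_neg, Complex.ofReal_one, mul_neg_one]
      exact (neg_smul _ _).symm
    · simp
  · simp [q, symplecticForm, Q.comm_pp]

/-- Passage from weak to operator identities: vectors of the dense domain separate points. -/
theorem eq_of_inner (Q : CanonicalObservables s 𝓗) {A B : Module.End ℂ Q.domain}
    (hAB : ∀ φ ψ : Q.domain, inner ℂ (φ : 𝓗) (A ψ : 𝓗) = inner ℂ (φ : 𝓗) (B ψ : 𝓗)) : A = B := by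
  refine LinearMap.ext fun ψ => Subtype.ext ?_
  exact Q.dense.eq_of_inner_right ℂ fun φ hφ => hAB ⟨φ, hφ⟩ ψ

theorem lie_smul_q (Q : CanonicalObservables s 𝓗) (c : Fin s ⊕ Fin s → ℂ) (j : Fin s ⊕ Fin s) :
    ⁅∑ i, c i • Q.q i, Q.q j⁆
      = (Complex.I * ∑ i, c i * (symplecticForm s i j : ℂ)) • (1 : Module.End ℂ Q.domain) := by
  simp only [sum_smul_lie, lie_q, smul_smul, Finset.mul_sum, Finset.sum_smul]
  exact Finset.sum_congr rfl fun i _ => by rw [mul_left_comm]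

instance (Q : CanonicalObservables s 𝓗) [Nontrivial 𝓗] : Nontrivial Q.domain := by
  by_contra hn
  rw [not_nontrivial_iff_subsingleton, Submodule.subsingleton_iff_eq_bot] at hn
  have := Q.dense
  rw [hn, Submodule.bot_coe, dense_iff_closure_eq, closure_singleton] at this
  obtain ⟨v, hv⟩ := exists_ne (0 : 𝓗)
  exact hv (this.symm ▸ Set.mem_univ v : v ∈ ({0} : Set 𝓗))

theorem smul_one_injective (Q : CanonicalObservables s 𝓗) [Nontrivial 𝓗] {c : ℂ}
    (hc : c • (1 : Module.End ℂ Q.domain) = 0) : c = 0 :=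
  (smul_eq_zero.mp hc).resolve_right one_ne_zero

/-- Commuting the relation with each `q_j` multiplies the coefficients by `Ω`, which only permutes
them up to sign. It makes the matrix `M` in `q(t) = M(t) q` unique. -/
theorem eq_zero_of_sum_smul_q (Q : CanonicalObservables s 𝓗) [Nontrivial 𝓗]
    {c : Fin s ⊕ Fin s → ℂ} (hc : ∑ i, c i • Q.q i = 0) : c = 0 := by
  have key : ∀ j, ∑ i, c i * (symplecticForm s i j : ℂ) = 0 := fun j => by
    have := Q.lie_smul_q c j
    rw [hc, Ring.lie_def, zero_mul, mul_zero, sub_zero] at this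
    simpa using Q.smul_one_injective this.symm
  funext i
  rcases i with i | i
  · simpa [symplecticForm, Matrix.one_apply, apply_ite Complex.ofReal] using key (Sum.inr i)
  · simpa [symplecticForm, Matrix.one_apply, apply_ite Complex.ofReal] using key (Sum.inl i)

theorem lie_quadratic_q (Q : CanonicalObservables s 𝓗)
    {h : Matrix (Fin s ⊕ Fin s) (Fin s ⊕ Fin s) ℝ} (hs : h.IsSymm) (i : Fin s ⊕ Fin s) :
    Complex.I • ⁅Q.quadratic h, Q.q i⁆
      = ∑ j, ((((2 : ℝ) • (symplecticForm s * h)) i j : ℝ) : ℂ) • Q.q j := by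
  have h1 : ∀ a b, ⁅Q.q a * Q.q b, Q.q i⁆ = (Complex.I * (symplecticForm s b i : ℂ)) • Q.q a
      + (Complex.I * (symplecticForm s a i : ℂ)) • Q.q b := fun a b => by
    have hb := Q.lie_q b i
    have ha := Q.lie_q a i
    rw [Ring.lie_def] at ha hb ⊢
    calc Q.q a * Q.q b * Q.q i - Q.q i * (Q.q a * Q.q b)
        = Q.q a * (Q.q b * Q.q i - Q.q i * Q.q b) + (Q.q a * Q.q i - Q.q i * Q.q a) * Q.q b := by
          simp only [mul_sub, sub_mul, mul_assoc]
          abel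
      _ = _ := by rw [ha, hb]; simp
  have h2 : ∀ a b, (Complex.I * (h a b : ℂ)) • ⁅Q.q a * Q.q b, Q.q i⁆
      = ((symplecticForm s i b * h b a : ℝ) : ℂ) • Q.q a
        + ((symplecticForm s i a * h a b : ℝ) : ℂ) • Q.q b := fun a b => by
    rw [h1, smul_add, smul_smul, smul_smul, symplecticForm_swap i b, symplecticForm_swap i a,
      hs.apply a b]
    congr 2 <;> push_cast <;> linear_combination
      (h a b : ℂ) * (symplecticForm s _ i : ℂ) * Complex.I_mul_I
  have h3 : ⁅Q.quadratic h, Q.q i⁆ = ∑ a, ∑ b, (h a b : ℂ) • ⁅Q.q a * Q.q b, Q.q i⁆ := by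
    simp only [quadratic, ← sum_smul_lie]
    simp only [Ring.lie_def, Finset.sum_mul, Finset.mul_sum, Finset.sum_sub_distrib]
  simp only [h3, Finset.smul_sum, smul_smul, h2, Finset.sum_add_distrib]
  -- The Leibniz rule gives two terms per product. After relabelling they coincide because `h` is
  -- symmetric, whence the factor 2.
  rw [Finset.sum_comm (f := fun a b => ((symplecticForm s i a * h a b : ℝ) : ℂ) • Q.q b),
    ← Finset.sum_add_distrib]
  refine Finset.sum_congr rfl fun j _ => ?_
  rw [← Finset.sum_smul, ← add_smul, Matrix.smul_apply, Matrix.mul_apply]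
  push_cast
  congr 1
  simp only [smul_eq_mul]
  push_cast
  ring

/-- A vector of coefficients of the positions, as a vector of coefficients of all observables. -/
def positionVector (F : Fin s → ℝ) : Fin s ⊕ Fin s → ℝ := Sum.elim F 0

theorem dot_x (Q : CanonicalObservables s 𝓗) (F : Fin s → ℝ) :
    Q.dot F Q.x = ∑ i, (positionVector F i : ℂ) • Q.q i := by
  simp [dot, positionVector, q, Fintype.sum_sum_type]

theorem lie_dot_q (Q : CanonicalObservables s 𝓗) (F : Fin s → ℝ) (i : Fin s ⊕ Fin s) :
    Complex.I • ⁅Q.dot F Q.x, Q.q i⁆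
      = ((-((positionVector F ᵥ* symplecticForm s) i) : ℝ) : ℂ) • (1 : Module.End ℂ Q.domain) := by
  rw [dot_x, lie_smul_q, smul_smul, ← mul_assoc, Complex.I_mul_I]
  simp [Matrix.vecMul, dotProduct]

end CanonicalObservables

/-! ### Linear differential equations with a conserved symplectic form -/

/-- A continuous solution of `y' = A y + b ⊗ m` outside the exceptional set `B`. -/
structure IsLinearSolution {ι V : Type*} [Fintype ι] [NormedAddCommGroup V] [NormedSpace ℝ V]
    (A : ℝ → Matrix ι ι ℝ) (b : ι → ℝ) (B : Set ℝ) (m : V) (y : ℝ → ι → V) : Prop where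
  continuous : ∀ i, Continuous fun t => y t i
  hasDerivAt : ∀ t, t ∉ B → ∀ i,
    HasDerivAt (fun r => y r i) (∑ j, A t i j • y t j + b i • m) t

/-- The columns of `M` are solutions of `w' = A w`, with the value `1` at `0`. -/
structure IsFundamentalMatrix {ι : Type*} [Fintype ι] [DecidableEq ι]
    (A : ℝ → Matrix ι ι ℝ) (B : Set ℝ) (M : ℝ → Matrix ι ι ℝ) : Prop where
  column : ∀ k, IsLinearSolution A 0 B (0 : ℝ) fun t i => M t i k
  zero : M 0 = 1

theorem eq_add_integral_of_hasDerivAt_off_countable {V : Type*} [NormedAddCommGroup V]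
    [NormedSpace ℝ V] [CompleteSpace V] {B : Set ℝ} (hB : B.Countable) {f f' : ℝ → V}
    (hf : Continuous f) (hf' : Continuous f') (hd : ∀ t, t ∉ B → HasDerivAt f (f' t) t) (a b : ℝ) :
    f b = f a + ∫ r in a..b, f' r := by
  rw [MeasureTheory.integral_eq_of_hasDerivAt_off_countable f f' hB hf.continuousOn
    (fun t ht => hd t ht.2) (hf'.intervalIntegrable _ _), add_sub_cancel]

theorem eq_of_hasDerivAt_zero_off_countable {V : Type*} [NormedAddCommGroup V]
    [NormedSpace ℝ V] [CompleteSpace V] {B : Set ℝ} (hB : B.Countable) {f : ℝ → V}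
    (hf : Continuous f) (hd : ∀ t, t ∉ B → HasDerivAt f 0 t) (a b : ℝ) : f b = f a := by
  simpa using eq_add_integral_of_hasDerivAt_off_countable hB hf continuous_const hd a b

namespace IsLinearSolution

variable {s : ℕ} {V : Type*} [NormedAddCommGroup V] [NormedSpace ℝ V]
  {A : ℝ → Matrix (Fin s ⊕ Fin s) (Fin s ⊕ Fin s) ℝ} {b : Fin s ⊕ Fin s → ℝ} {B : Set ℝ} {m : V}
  {y : ℝ → Fin s ⊕ Fin s → V} {w : ℝ → Fin s ⊕ Fin s → ℝ}

theorem continuous_mulVec (hw : IsLinearSolution A 0 B (0 : ℝ) w) :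
    Continuous fun t => symplecticForm s *ᵥ w t :=
  Continuous.matrix_mulVec continuous_const (continuous_pi hw.continuous)

/-- In the derivative of the pairing `Ωw · y` the terms with `A` cancel, since `ΩA + AᵀΩ = 0`. Only
`Ωw · b` remains, which is continuous even where `A` jumps, so the fundamental theorem of calculus
applies off a countable set. -/
theorem symplectic_pairing [CompleteSpace V] (hB : B.Countable)
    (hA : ∀ t, (A t)ᵀ * symplecticForm s = -(symplecticForm s * A t))
    (hy : IsLinearSolution A b B m y) (hw : IsLinearSolution A 0 B (0 : ℝ) w) (t : ℝ) :
    ∑ i, (symplecticForm s *ᵥ w t) i • y t i = ∑ i, (symplecticForm s *ᵥ w 0) i • y 0 i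
      + (∫ r in (0 : ℝ)..t, (symplecticForm s *ᵥ w r) ⬝ᵥ b) • m := by
  have hΩ := hw.continuous_mulVec
  have hw' : ∀ t, t ∉ B → HasDerivAt w (A t *ᵥ w t) t := fun t ht =>
    hasDerivAt_pi.mpr fun i => by
      simpa [Matrix.mulVec, dotProduct] using hw.hasDerivAt t ht i
  have hΩw : ∀ t, t ∉ B → ∀ i, HasDerivAt (fun r => (symplecticForm s *ᵥ w r) i)
      ((symplecticForm s *ᵥ (A t *ᵥ w t)) i) t := fun t ht i => by
    simp only [Matrix.mulVec, dotProduct]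
    exact HasDerivAt.fun_sum fun j _ => (hasDerivAt_pi.mp (hw' t ht) j).const_mul _
  rw [← intervalIntegral.integral_smul_const]
  refine eq_add_integral_of_hasDerivAt_off_countable (f := fun t =>
      ∑ i, (symplecticForm s *ᵥ w t) i • y t i) hB ?_ ?_ (fun t ht => ?_) 0 t
  · exact continuous_finsetSum _ fun i _ =>
      ((continuous_apply i).comp hΩ).smul (hy.continuous i)
  · exact (hΩ.dotProduct continuous_const).smul continuous_const
  · have h1 : ∀ j, (symplecticForm s *ᵥ (A t *ᵥ w t)) j
        + ∑ i, (symplecticForm s *ᵥ w t) i * A t i j = 0 := fun j => by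
      have h2 : ∑ i, (symplecticForm s *ᵥ w t) i * A t i j
          = ((A t)ᵀ *ᵥ (symplecticForm s *ᵥ w t)) j := by
        simp only [Matrix.mulVec, dotProduct, Matrix.transpose_apply, mul_comm]
      rw [h2, Matrix.mulVec_mulVec, Matrix.mulVec_mulVec, hA, Matrix.neg_mulVec, Pi.neg_apply,
        add_neg_cancel]
    refine (HasDerivAt.fun_sum fun i _ => (hΩw t ht i).smul (hy.hasDerivAt t ht i)).congr_deriv ?_
    simp only [smul_add, Finset.sum_add_distrib, Finset.smul_sum, smul_smul]
    rw [Finset.sum_comm (f := fun i j => ((symplecticForm s *ᵥ w t) i * A t i j) • y t j),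
      add_right_comm, ← Finset.sum_add_distrib, dotProduct, Finset.sum_smul]
    simp only [← Finset.sum_smul, ← add_smul, add_comm _ ((symplecticForm s *ᵥ (A t *ᵥ w t)) _),
      h1, zero_smul, Finset.sum_const_zero, zero_add]

end IsLinearSolution

namespace IsFundamentalMatrix

variable {s : ℕ} {A : ℝ → Matrix (Fin s ⊕ Fin s) (Fin s ⊕ Fin s) ℝ} {B : Set ℝ}
  {M : ℝ → Matrix (Fin s ⊕ Fin s) (Fin s ⊕ Fin s) ℝ}

theorem continuous (hM : IsFundamentalMatrix A B M) : Continuous M :=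
  continuous_matrix fun i k => (hM.column k).continuous i

theorem transpose_mul_mul (hM : IsFundamentalMatrix A B M) (hB : B.Countable)
    (hA : ∀ t, (A t)ᵀ * symplecticForm s = -(symplecticForm s * A t)) (t : ℝ) :
    (symplecticForm s * M t)ᵀ * M t = (symplecticForm s)ᵀ := by
  ext k l
  have := (hM.column l).symplectic_pairing hB hA (hM.column k) t
  have h0 : (symplecticForm s * M 0)ᵀ * M 0 = (symplecticForm s)ᵀ := by simp [hM.zero]
  rw [← h0]
  simp only [dotProduct_zero, intervalIntegral.integral_zero, zero_smul, add_zero] at this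
  exact this

theorem mul_inverse (hM : IsFundamentalMatrix A B M) (hB : B.Countable)
    (hA : ∀ t, (A t)ᵀ * symplecticForm s = -(symplecticForm s * A t)) (t : ℝ) :
    M t * (symplecticForm s * (symplecticForm s * M t)ᵀ) = 1 := by
  rw [mul_eq_one_comm, mul_assoc, hM.transpose_mul_mul hB hA, symplecticForm_transpose, mul_neg,
    symplecticForm_mul_self, neg_neg]

/-- Variation of constants, for the inhomogeneity `Ωᵀ f`. -/
theorem solution_eq {V : Type*} [NormedAddCommGroup V] [NormedSpace ℝ V] [CompleteSpace V] {m : V}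
    {y : ℝ → Fin s ⊕ Fin s → V} {f : Fin s ⊕ Fin s → ℝ}
    (hM : IsFundamentalMatrix A B M) (hB : B.Countable)
    (hA : ∀ t, (A t)ᵀ * symplecticForm s = -(symplecticForm s * A t))
    (hy : IsLinearSolution A (f ᵥ* symplecticForm s) B m y) (t : ℝ) (i : Fin s ⊕ Fin s) :
    y t i = ∑ j, M t i j • y 0 j
      - ((M t * symplecticForm s) *ᵥ fun k => ∫ r in (0 : ℝ)..t, (f ᵥ* M r) k) i • m := by
  -- Pairing `y` with the columns of `M` determines `(ΩM)ᵀ y`; by `mul_inverse`, `L` undoes the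
  -- factor `(ΩM)ᵀ`.
  set L := M t * symplecticForm s with hL
  have h1 : ∀ k, ∑ j, (symplecticForm s * M t) j k • y t j = ∑ j, symplecticForm s j k • y 0 j
      - (∫ r in (0 : ℝ)..t, (f ᵥ* M r) k) • m := fun k => by
    have h2 : ∀ r, (symplecticForm s *ᵥ fun i => M r i k) ⬝ᵥ (f ᵥ* symplecticForm s)
        = -(f ᵥ* M r) k := fun r => by
      rw [dotProduct_comm, ← Matrix.dotProduct_mulVec, Matrix.mulVec_mulVec,
        symplecticForm_mul_self, Matrix.neg_mulVec, Matrix.one_mulVec, dotProduct_neg]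
      rfl
    have := hy.symplectic_pairing hB hA (hM.column k) t
    simp only [h2, hM.zero, intervalIntegral.integral_neg] at this
    rw [sub_eq_add_neg, ← neg_smul]
    refine this.trans ?_
    simp only [Matrix.mulVec, dotProduct, Matrix.one_apply, mul_ite, mul_one, mul_zero,
      Finset.sum_ite_eq', Finset.mem_univ, if_true]
  have h3 : ∀ j, ∑ k, L i k * (symplecticForm s * M t) j k = (1 : Matrix _ _ ℝ) i j := fun j => by
    rw [← hM.mul_inverse hB hA t, ← mul_assoc, ← hL, Matrix.mul_apply]
    rfl
  have h4 : ∀ j, ∑ k, L i k * symplecticForm s j k = M t i j := fun j => by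
    have : L * (symplecticForm s)ᵀ = M t := by
      rw [hL, symplecticForm_transpose, mul_neg, mul_assoc, symplecticForm_mul_self, mul_neg,
        mul_one, neg_neg]
    conv_rhs => rw [← this, Matrix.mul_apply]
    rfl
  calc y t i = ∑ j, (1 : Matrix _ _ ℝ) i j • y t j := by simp [Matrix.one_apply]
    _ = ∑ k, L i k • ∑ j, (symplecticForm s * M t) j k • y t j := by
      simp only [← h3, Finset.sum_smul, Finset.smul_sum, smul_smul]
      exact Finset.sum_comm
    _ = _ := by
      simp only [h1, smul_sub, Finset.sum_sub_distrib, Finset.smul_sum, smul_smul]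
      rw [Finset.sum_comm]
      simp only [← Finset.sum_smul, h4]
      rfl

end IsFundamentalMatrix

theorem IsLinearSolution.add {ι V : Type*} [Fintype ι] [NormedAddCommGroup V] [NormedSpace ℝ V]
    {A : ℝ → Matrix ι ι ℝ} {B : Set ℝ} {y z : ℝ → ι → V} (hy : IsLinearSolution A 0 B 0 y)
    (hz : IsLinearSolution A 0 B 0 z) : IsLinearSolution A 0 B 0 (y + z) where
  continuous i := (hy.continuous i).add (hz.continuous i)
  hasDerivAt t ht i := by
    refine ((hy.hasDerivAt t ht i).add (hz.hasDerivAt t ht i)).congr_deriv ?_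
    simp [smul_add, Finset.sum_add_distrib]

/-- Matrix elements for different `φ, ψ` carry different `m`; setting `m` to 0 lets them be added.
-/
theorem IsLinearSolution.of_homogeneous {ι V : Type*} [Fintype ι] [NormedAddCommGroup V]
    [NormedSpace ℝ V] {A : ℝ → Matrix ι ι ℝ} {B : Set ℝ} {y : ℝ → ι → V} {m : V}
    (hy : IsLinearSolution A 0 B m y) : IsLinearSolution A 0 B 0 y where
  continuous := hy.continuous
  hasDerivAt t ht i := by simpa using hy.hasDerivAt t ht i

theorem IsLinearSolution.zero {ι V : Type*} [Fintype ι] [NormedAddCommGroup V] [NormedSpace ℝ V]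
    {A : ℝ → Matrix ι ι ℝ} {B : Set ℝ} : IsLinearSolution A 0 B 0 (0 : ℝ → ι → V) where
  continuous i := continuous_const
  hasDerivAt t ht i := by simpa using hasDerivAt_const t (0 : V)

theorem IsLinearSolution.map {ι V W : Type*} [Fintype ι] [NormedAddCommGroup V] [NormedSpace ℝ V]
    [NormedAddCommGroup W] [NormedSpace ℝ W] {A : ℝ → Matrix ι ι ℝ} {b : ι → ℝ} {B : Set ℝ} {m : V}
    {y : ℝ → ι → V} (hy : IsLinearSolution A b B m y) (L : V →L[ℝ] W) :
    IsLinearSolution A b B (L m) fun t i => L (y t i) where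
  continuous i := L.continuous.comp (hy.continuous i)
  hasDerivAt t ht i := by
    refine (L.hasFDerivAt.comp_hasDerivAt t (hy.hasDerivAt t ht i)).congr_deriv ?_
    simp

/-! ### Heisenberg equations for matrix elements -/

/-- A product rule in which `b`, here `A U(r) ψ`, is merely continuous. Split `f r = (f r - f t) + f
t`: the first part needs only the limit of `b`, and in the second the symmetric operator moves to
the fixed left vector. -/
theorem hasDerivAt_inner_of_symmetric {𝓗 : Type*} [NormedAddCommGroup 𝓗] [InnerProductSpace ℂ 𝓗]
    {f g b : ℝ → 𝓗} {f' g' a : 𝓗} {t : ℝ} (hf : HasDerivAt f f' t) (hg : HasDerivAt g g' t)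
    (hb : ContinuousAt b t) (hab : ∀ r, inner ℂ (f t) (b r) = inner ℂ a (g r)) :
    HasDerivAt (fun r => inner ℂ (f r) (b r)) (inner ℂ f' (b t) + inner ℂ a g') t := by
  have h1 : HasDerivAt (fun r => inner ℂ (f r - f t) (b r)) (inner ℂ f' (b t)) t := by
    rw [hasDerivAt_iff_tendsto_slope] at hf ⊢
    refine ((hf.inner (𝕜 := ℂ) (hb.tendsto.mono_left nhdsWithin_le_nhds))).congr fun r => ?_
    simp only [slope, vsub_eq_sub, sub_self, inner_zero_left, sub_zero]
    rw [RCLike.real_smul_eq_coe_smul (K := ℂ), inner_smul_left, RCLike.real_smul_eq_coe_mul,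
      inner_sub_left]
    simp
  have h2 : HasDerivAt (fun r => inner ℂ a (g r)) (inner ℂ a g') t := by
    simpa using (hasDerivAt_const t a).inner ℂ hg
  refine (h1.add h2).congr_of_eventuallyEq (Eventually.of_forall fun r => ?_)
  rw [Pi.add_apply, ← hab r, inner_sub_left, sub_add_cancel]

namespace CanonicalObservables

namespace Evolution

variable {s : ℕ} {𝓗 : Type*} [NormedAddCommGroup 𝓗] [InnerProductSpace ℂ 𝓗]
  {Q : CanonicalObservables s 𝓗} {H : ℝ → Module.End ℂ Q.domain} {B : Set ℝ}

theorem coe_onDomain (E : Q.Evolution H B) (t τ : ℝ) (ψ : Q.domain) :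
    (E.onDomain t τ ψ : 𝓗) = E.U t τ ψ := rfl

theorem onDomain_self (E : Q.Evolution H B) (t : ℝ) : E.onDomain t t = 1 :=
  LinearMap.ext fun ψ => Subtype.ext <| by rw [coe_onDomain, E.U_self]; rfl

theorem onDomain_mul (E : Q.Evolution H B) (t τ σ : ℝ) :
    E.onDomain t τ * E.onDomain τ σ = E.onDomain t σ :=
  LinearMap.ext fun ψ => Subtype.ext <| by rw [coe_onDomain, ← E.U_mul t τ σ]; rfl

theorem heisenberg_zero_time (E : Q.Evolution H B) (A : Module.End ℂ Q.domain) :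
    E.heisenberg A 0 = A := by
  rw [heisenberg, onDomain_self, one_mul, mul_one]

theorem heisenberg_one (E : Q.Evolution H B) (t : ℝ) : E.heisenberg 1 t = 1 := by
  rw [heisenberg, mul_one, onDomain_mul, onDomain_self]

theorem heisenberg_add (E : Q.Evolution H B) (A C : Module.End ℂ Q.domain) (t : ℝ) :
    E.heisenberg (A + C) t = E.heisenberg A t + E.heisenberg C t := by
  simp only [heisenberg, mul_add, add_mul]

theorem heisenberg_smul (E : Q.Evolution H B) (c : ℂ) (A : Module.End ℂ Q.domain) (t : ℝ) :
    E.heisenberg (c • A) t = c • E.heisenberg A t := by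
  simp only [heisenberg, mul_smul_comm, smul_mul_assoc]

theorem heisenberg_sum {ι : Type*} [Fintype ι] (E : Q.Evolution H B)
    (A : ι → Module.End ℂ Q.domain) (t : ℝ) :
    E.heisenberg (∑ i, A i) t = ∑ i, E.heisenberg (A i) t := by
  simp only [heisenberg, Finset.mul_sum, Finset.sum_mul]

theorem inner_U_right (E : Q.Evolution H B) (t τ : ℝ) (φ ψ : 𝓗) :
    inner ℂ φ (E.U τ t ψ) = inner ℂ (E.U t τ φ) ψ := by
  rw [← (E.U t τ).inner_map_map φ (E.U τ t ψ)]
  change inner ℂ _ ((E.U t τ * E.U τ t) ψ) = _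
  rw [E.U_mul, E.U_self]
  rfl

theorem inner_heisenberg (E : Q.Evolution H B) (A : Module.End ℂ Q.domain) (t : ℝ)
    (φ ψ : Q.domain) : inner ℂ (φ : 𝓗) (E.heisenberg A t ψ : 𝓗)
      = inner ℂ (E.U t 0 (φ : 𝓗)) (A (E.onDomain t 0 ψ) : 𝓗) :=
  E.inner_U_right t 0 _ _

theorem hasDerivAt_inner_heisenberg (E : Q.Evolution H B) {A : Module.End ℂ Q.domain} {t : ℝ}
    (hH : Q.IsSymmetricOp (H t)) (hA : Q.IsSymmetricOp A) (ht : t ∉ B) (φ ψ : Q.domain)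
    (hc : Continuous fun r => (A (E.onDomain r 0 ψ) : 𝓗)) :
    HasDerivAt (fun r => inner ℂ (φ : 𝓗) (E.heisenberg A r ψ : 𝓗))
      (inner ℂ (φ : 𝓗) (E.heisenberg (Complex.I • ⁅H t, A⁆) t ψ : 𝓗)) t := by
  simp only [inner_heisenberg]
  refine (hasDerivAt_inner_of_symmetric (E.hasDerivAt_U t 0 φ ht) (E.hasDerivAt_U t 0 ψ ht)
    hc.continuousAt (a := (A (E.onDomain t 0 φ) : 𝓗))
    fun r => (hA (E.onDomain t 0 φ) (E.onDomain r 0 ψ)).symm).congr_deriv ?_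
  change inner ℂ (-Complex.I • (H t (E.onDomain t 0 φ) : 𝓗)) (A (E.onDomain t 0 ψ) : 𝓗)
    + inner ℂ (A (E.onDomain t 0 φ) : 𝓗) (-Complex.I • (H t (E.onDomain t 0 ψ) : 𝓗)) = _
  rw [inner_smul_left, inner_smul_right, hH, hA, ← E.coe_onDomain, Ring.lie_def,
    LinearMap.smul_apply, LinearMap.sub_apply, Submodule.coe_smul, Submodule.coe_sub,
    inner_smul_right, inner_sub_right]
  simp only [map_neg, Complex.conj_I, Module.End.mul_apply]
  ring

theorem continuous_inner_heisenberg (E : Q.Evolution H B) (i : Fin s ⊕ Fin s) (φ ψ : Q.domain) :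
    Continuous fun r => inner ℂ (φ : 𝓗) (E.heisenberg (Q.q i) r ψ : 𝓗) := by
  simp only [inner_heisenberg]
  exact (E.continuous_U 0 φ).inner (E.continuous_qU 0 i ψ)

/-- The inhomogeneity is multiplied by `⟪φ, ψ⟫`, the matrix element of the identity, which does not
evolve. -/
theorem isLinearSolution (E : Q.Evolution H B)
    {A : ℝ → Matrix (Fin s ⊕ Fin s) (Fin s ⊕ Fin s) ℝ} {b : Fin s ⊕ Fin s → ℝ}
    (hH : ∀ t, Q.IsSymmetricOp (H t))
    (hA : ∀ t i, Complex.I • ⁅H t, Q.q i⁆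
      = ∑ j, (A t i j : ℂ) • Q.q j + (b i : ℂ) • (1 : Module.End ℂ Q.domain)) (φ ψ : Q.domain) :
    IsLinearSolution A b B (inner ℂ (φ : 𝓗) (ψ : 𝓗))
      fun t i => inner ℂ (φ : 𝓗) (E.heisenberg (Q.q i) t ψ : 𝓗) where
  continuous i := E.continuous_inner_heisenberg i φ ψ
  hasDerivAt t ht i := by
    refine (E.hasDerivAt_inner_heisenberg (hH t) (Q.q_symm i) ht φ ψ
      (E.continuous_qU 0 i ψ)).congr_deriv ?_
    rw [hA, heisenberg_add, heisenberg_smul, heisenberg_one, heisenberg_sum]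
    simp only [heisenberg_smul, LinearMap.add_apply, LinearMap.sum_apply, LinearMap.smul_apply,
      Submodule.coe_add, Submodule.coe_sum, Submodule.coe_smul, inner_add_right, inner_sum,
      inner_smul_right, Complex.real_smul, Module.End.one_apply]

theorem exists_isFundamentalMatrix [Nontrivial 𝓗] (E : Q.Evolution H B)
    {A : ℝ → Matrix (Fin s ⊕ Fin s) (Fin s ⊕ Fin s) ℝ}
    (hE : ∀ φ ψ : Q.domain, IsLinearSolution A 0 B (0 : ℂ)
      fun t i => inner ℂ (φ : 𝓗) (E.heisenberg (Q.q i) t ψ : 𝓗)) :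
    ∃ M, IsFundamentalMatrix A B M := by
  set W : Submodule ℂ (ℝ → Fin s ⊕ Fin s → ℂ) := Submodule.span ℂ (Set.range
    fun (x : Q.domain × Q.domain) t i => inner ℂ (x.1 : 𝓗) (E.heisenberg (Q.q i) t x.2 : 𝓗)) with hW
  have hsol : ∀ w ∈ W, IsLinearSolution A 0 B 0 w := fun w hw => by
    induction hw using Submodule.span_induction with
    | mem w hw =>
      obtain ⟨x, rfl⟩ := hw
      exact hE x.1 x.2
    | zero => exact IsLinearSolution.zero
    | add w v _ _ hw hv => exact hw.add hv
    | smul c w _ hw =>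
      have := hw.map ((ContinuousLinearMap.mul ℂ ℂ c).restrictScalars ℝ)
      rwa [map_zero] at this
  -- A nonzero functional that kills all initial values `(⟪φ, q_i ψ⟫)_i` would be a linear relation
  -- among the `q_i`.
  have htop : W.map (LinearMap.proj 0) = ⊤ := by
    by_contra hne
    obtain ⟨f, hf, hle⟩ := Submodule.exists_le_ker_of_lt_top _ (lt_top_iff_ne_top.mpr hne)
    have hsum : ∀ v : Fin s ⊕ Fin s → ℂ, f v = ∑ i, f (Pi.single i 1) * v i := fun v => by
      conv_lhs => rw [LinearMap.pi_apply_eq_sum_univ f v]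
      exact Finset.sum_congr rfl fun i _ => by
        rw [smul_eq_mul, mul_comm]
        congr 2
        ext j
        simp [Pi.single_apply, eq_comm]
    have hz : ∑ i, f (Pi.single i 1) • Q.q i = 0 := Q.eq_of_inner fun φ ψ => by
      have : f (fun i => inner ℂ (φ : 𝓗) (Q.q i ψ : 𝓗)) = 0 := by
        refine hle (Submodule.mem_map.mpr ⟨_, Submodule.subset_span ⟨(φ, ψ), rfl⟩, ?_⟩)
        simp [heisenberg_zero_time]
      rw [hsum] at this
      simpa [inner_sum, inner_smul_right] using this
    refine hf (LinearMap.ext fun v => ?_)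
    rw [hsum, LinearMap.zero_apply]
    exact Finset.sum_eq_zero fun i _ => by
      rw [show f (Pi.single i 1) = 0 from congrFun (Q.eq_zero_of_sum_smul_q hz) i, zero_mul]
  have hex : ∀ k, ∃ w ∈ W, w 0 = Pi.single k 1 := fun k => by
    have : Pi.single k 1 ∈ W.map (LinearMap.proj (R := ℂ) (φ := fun _ : ℝ => Fin s ⊕ Fin s → ℂ) 0) :=
      htop ▸ Submodule.mem_top
    exact Submodule.mem_map.mp this
  choose w hw hw0 using hex
  -- Since `A` is real, real parts of solutions are solutions.
  refine ⟨fun t => Matrix.of fun i k => (w k t i).re, fun k => ?_, ?_⟩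
  · simpa using (hsol _ (hw k)).map Complex.reCLM
  · ext i k
    rw [Matrix.of_apply, hw0, Pi.single_apply, Matrix.one_apply]
    split_ifs <;> simp

theorem heisenberg_q (E : Q.Evolution H B)
    {A M : ℝ → Matrix (Fin s ⊕ Fin s) (Fin s ⊕ Fin s) ℝ} {f : Fin s ⊕ Fin s → ℝ}
    (hB : B.Countable) (hH : ∀ t, Q.IsSymmetricOp (H t))
    (hA : ∀ t, (A t)ᵀ * symplecticForm s = -(symplecticForm s * A t))
    (hHA : ∀ t i, Complex.I • ⁅H t, Q.q i⁆
      = ∑ j, (A t i j : ℂ) • Q.q j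
        + ((f ᵥ* symplecticForm s) i : ℂ) • (1 : Module.End ℂ Q.domain))
    (hM : IsFundamentalMatrix A B M) (t : ℝ) (i : Fin s ⊕ Fin s) :
    E.heisenberg (Q.q i) t = ∑ j, (M t i j : ℂ) • Q.q j
      - (((M t * symplecticForm s) *ᵥ fun k => ∫ r in (0 : ℝ)..t, (f ᵥ* M r) k) i : ℂ)
        • (1 : Module.End ℂ Q.domain) := by
  refine Q.eq_of_inner fun φ ψ => ?_
  rw [hM.solution_eq hB hA (E.isLinearSolution hH hHA φ ψ) t i]
  simp only [heisenberg_zero_time, LinearMap.sub_apply, LinearMap.sum_apply, LinearMap.smul_apply,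
    Submodule.coe_sub, Submodule.coe_sum, Submodule.coe_smul, inner_sub_right, inner_sum,
    inner_smul_right, Complex.real_smul, Module.End.one_apply]

/-- Both sides solve the same equation with a symmetric generator, so the inner product of the two
evolved vectors is constant in time. -/
theorem U_add_period (E : Q.Evolution H B) (hB : B.Countable) (hH : ∀ t, Q.IsSymmetricOp (H t))
    {T : ℝ} (hHT : Function.Periodic H T) (hBT : ∀ t, t + T ∈ B → t ∈ B) (t τ : ℝ) :
    E.U (t + T) (τ + T) = E.U t τ := by
  have hinner : ∀ φ ψ : Q.domain, inner ℂ (E.U (t + T) (τ + T) (φ : 𝓗)) (E.U t τ (ψ : 𝓗))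
      = inner ℂ (φ : 𝓗) (ψ : 𝓗) := fun φ ψ => by
    have := eq_of_hasDerivAt_zero_off_countable hB
      (f := fun r => inner ℂ (E.U (r + T) (τ + T) (φ : 𝓗)) (E.U r τ (ψ : 𝓗)))
      (((E.continuous_U (τ + T) φ).comp (continuous_add_const T)).inner (E.continuous_U τ ψ))
      (fun r hr => ?_) τ t
    · simpa [E.U_self] using this
    · have h1 := (E.hasDerivAt_U (r + T) (τ + T) φ (fun h => hr (hBT r h))).comp_add_const r T
      refine (h1.inner ℂ (E.hasDerivAt_U r τ ψ hr)).congr_deriv ?_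
      have h2 := hH r ⟨_, E.U_mem (r + T) (τ + T) φ⟩ ⟨_, E.U_mem r τ ψ⟩
      dsimp only at h2
      rw [hHT r, inner_smul_left, inner_smul_right, h2]
      simp
  have hD : ∀ φ ∈ Q.domain, E.U (t + T) (τ + T) φ = E.U t τ φ := fun φ hφ => by
    refine Q.dense.eq_of_inner_left ℂ fun χ hχ => ?_
    have h1 : E.U t τ (E.U τ t χ) = χ := by
      change (E.U t τ * E.U τ t) χ = χ
      rw [E.U_mul, E.U_self]
      rfl
    -- The second vector is chosen so that `E.U t τ` carries it to `χ`.
    have h2 := hinner ⟨φ, hφ⟩ ⟨E.U τ t χ, E.U_mem τ t ⟨χ, hχ⟩⟩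
    rw [← (E.U t τ).inner_map_map φ] at h2
    simpa only [h1] using h2
  refine LinearIsometryEquiv.ext fun φ => ?_
  exact congrFun (Continuous.ext_on Q.dense (E.U (t + T) (τ + T)).continuous (E.U t τ).continuous
    hD) φ

theorem U_add_period_zero (E : Q.Evolution H B) (hB : B.Countable)
    (hH : ∀ t, Q.IsSymmetricOp (H t)) {T : ℝ} (hHT : Function.Periodic H T)
    (hBT : ∀ t, t + T ∈ B → t ∈ B) (t : ℝ) : E.U (t + T) 0 = E.U t 0 * E.U T 0 := by
  rw [← E.U_mul (t + T) T 0]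
  congr 1
  simpa using E.U_add_period hB hH hHT hBT t 0

end Evolution

end CanonicalObservables

/-! ### Period averages, the center and its drift velocity -/

theorem Function.Periodic.intervalIntegral_zero_add_nat_mul {p : ℝ → ℝ} {T : ℝ}
    (hp : Function.Periodic p T) (hc : Continuous p) (t : ℝ) (n : ℕ) :
    ∫ r in (0 : ℝ)..(t + n * T), p r = (∫ r in (0 : ℝ)..t, p r) + n * ∫ r in (0 : ℝ)..T, p r := by
  have := hp.intervalIntegral_add_zsmul_eq n t fun a b => hc.intervalIntegrable a b
  rw [← intervalIntegral.integral_add_adjacent_intervals (hc.intervalIntegrable 0 t)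
    (hc.intervalIntegrable t _)]
  simpa [hp.intervalIntegral_add_eq t 0] using this

namespace CanonicalObservables

variable {s : ℕ}

theorem positionVector_vecMul (F : Fin s → ℝ) (M : Matrix (Fin s ⊕ Fin s) (Fin s ⊕ Fin s) ℝ)
    (k : Fin s ⊕ Fin s) : (positionVector F ᵥ* M) k = ∑ l, F l * M (Sum.inl l) k := by
  simp [positionVector, Matrix.vecMul, dotProduct, Fintype.sum_sum_type]

theorem positionVector_zero : positionVector (0 : Fin s → ℝ) = 0 := by
  ext i
  rcases i with i | i <;> rfl

/-- The coefficients of the time averages of the positions. -/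
noncomputable def centerMatrix (M : ℝ → Matrix (Fin s ⊕ Fin s) (Fin s ⊕ Fin s) ℝ) (T : ℝ) :
    Matrix (Fin s) (Fin s ⊕ Fin s) ℝ :=
  Matrix.of fun j i => T⁻¹ * ∫ r in (0 : ℝ)..T, M r (Sum.inl j) i

/-- The integral of the coefficients of the force term `F · x(r)` over `[0, t]`. -/
noncomputable def forceIntegral (M : ℝ → Matrix (Fin s ⊕ Fin s) (Fin s ⊕ Fin s) ℝ)
    (F : Fin s → ℝ) (t : ℝ) : Fin s ⊕ Fin s → ℝ :=
  fun k => ∫ r in (0 : ℝ)..t, (positionVector F ᵥ* M r) k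

section Integrals

variable {M : ℝ → Matrix (Fin s ⊕ Fin s) (Fin s ⊕ Fin s) ℝ} {T : ℝ}

theorem continuous_vecMul (hM : Continuous M) (F : Fin s → ℝ) (k : Fin s ⊕ Fin s) :
    Continuous fun r => (positionVector F ᵥ* M r) k :=
  (continuous_apply k).comp (Continuous.matrix_vecMul continuous_const hM)

theorem hasDerivAt_forceIntegral (hM : Continuous M) (F : Fin s → ℝ) (t : ℝ)
    (k : Fin s ⊕ Fin s) :
    HasDerivAt (fun r => forceIntegral M F r k) ((positionVector F ᵥ* M t) k) t :=
  intervalIntegral.integral_hasDerivAt_right ((continuous_vecMul hM F k).intervalIntegrable _ _)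
    (continuous_vecMul hM F k).stronglyMeasurable.stronglyMeasurableAtFilter
    (continuous_vecMul hM F k).continuousAt

theorem continuous_forceIntegral (hM : Continuous M) (F : Fin s → ℝ) :
    Continuous (forceIntegral M F) :=
  continuous_pi fun k =>
    continuous_iff_continuousAt.mpr fun t => (hasDerivAt_forceIntegral hM F t k).continuousAt

theorem integral_period (hT : 0 < T) (hp : Function.Periodic M T) (τ : ℝ)
    (j : Fin s) (i : Fin s ⊕ Fin s) :
    ∫ r in τ..(τ + T), M r (Sum.inl j) i = T * centerMatrix M T j i := by
  have hpe : Function.Periodic (fun r => M r (Sum.inl j) i) T := fun r => by simp only [hp r]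
  rw [hpe.intervalIntegral_add_eq τ 0, zero_add, centerMatrix, Matrix.of_apply,
    mul_inv_cancel_left₀ hT.ne']

/-- The source of the drift: the integrand is periodic, and over one period the position rows of `M`
integrate to `T` times the center coefficients. -/
theorem forceIntegral_add_nat_mul (hM : Continuous M) (hT : 0 < T) (hp : Function.Periodic M T)
    (F : Fin s → ℝ) (t : ℝ) (n : ℕ) :
    forceIntegral M F (t + n * T) = forceIntegral M F t + (n * T) • (F ᵥ* centerMatrix M T) := by
  ext k
  have hpe : Function.Periodic (fun r => (positionVector F ᵥ* M r) k) T := fun r => by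
    simp only [hp r]
  have hI : ∫ r in (0 : ℝ)..T, (positionVector F ᵥ* M r) k = T * (F ᵥ* centerMatrix M T) k := by
    have h0 := fun l => integral_period hT hp 0 l k
    simp only [zero_add] at h0
    simp only [positionVector_vecMul]
    rw [intervalIntegral.integral_finsetSum fun l _ =>
      ((hM.matrix_elem (Sum.inl l) k).const_mul (F l)).intervalIntegrable _ _]
    simp only [intervalIntegral.integral_const_mul, h0, Matrix.vecMul, dotProduct, Finset.mul_sum]
    exact Finset.sum_congr rfl fun l _ => mul_left_comm _ _ _
  rw [forceIntegral, hpe.intervalIntegral_zero_add_nat_mul (continuous_vecMul hM F k), hI,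
    Pi.add_apply, Pi.smul_apply, smul_eq_mul, mul_assoc, forceIntegral]

theorem driftVelocity_center (u : Matrix (Fin s) (Fin s ⊕ Fin s) ℝ) (F : Fin s → ℝ) (k : Fin s) :
    driftVelocity (u * symplecticForm s * uᵀ) F k
      = -(u k ⬝ᵥ (symplecticForm s *ᵥ (F ᵥ* u))) := by
  have h1 : driftVelocity (u * symplecticForm s * uᵀ) F k
      = (F ᵥ* (u * symplecticForm s * uᵀ)) k := by
    simp only [driftVelocity, Matrix.vecMul, dotProduct, mul_comm]
  have h2 : (F ᵥ* u) ᵥ* symplecticForm s = -(symplecticForm s *ᵥ (F ᵥ* u)) := by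
    rw [← Matrix.mulVec_transpose, symplecticForm_transpose, Matrix.neg_mulVec]
  rw [h1, ← Matrix.vecMul_vecMul, ← Matrix.vecMul_vecMul, h2, Matrix.neg_vecMul, Pi.neg_apply,
    dotProduct_comm]
  rfl

theorem dotProduct_driftVelocity {κ : Matrix (Fin s) (Fin s) ℝ} (hκ : κᵀ = -κ) (F : Fin s → ℝ) :
    F ⬝ᵥ driftVelocity κ F = 0 := by
  have h1 : driftVelocity κ F = κᵀ *ᵥ F := rfl
  have h2 : F ⬝ᵥ (κᵀ *ᵥ F) = F ⬝ᵥ (κ *ᵥ F) := by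
    rw [Matrix.mulVec_transpose, dotProduct_comm, ← Matrix.dotProduct_mulVec]
  have h3 : F ⬝ᵥ (κᵀ *ᵥ F) = -(F ⬝ᵥ (κ *ᵥ F)) := by
    rw [hκ, Matrix.neg_mulVec, dotProduct_neg]
  rw [h1]
  linarith

theorem center_form_transpose (u : Matrix (Fin s) (Fin s ⊕ Fin s) ℝ) :
    (u * symplecticForm s * uᵀ)ᵀ = -(u * symplecticForm s * uᵀ) := by
  simp [Matrix.transpose_mul, symplecticForm_transpose, Matrix.mul_assoc]

/-- The numerical part of the position in a constant force. -/
noncomputable def forcedShift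
    (M : ℝ → Matrix (Fin s ⊕ Fin s) (Fin s ⊕ Fin s) ℝ)
    (F : Fin s → ℝ) (k : Fin s) (t : ℝ) : ℝ :=
  -((M t * symplecticForm s) *ᵥ forceIntegral M F t) (Sum.inl k)

theorem continuous_forcedShift (hc : Continuous M) (F : Fin s → ℝ)
    (k : Fin s) : Continuous (forcedShift M F k) :=
  ((continuous_apply (Sum.inl k)).comp (Continuous.matrix_mulVec
    (hc.matrix_mul continuous_const) (continuous_forceIntegral hc F))).neg

/-- A delay by `n` periods changes the shift by `-nT (M Ω (F u))_k`. Averaging over a period turns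
the row of `M` into `u k`, and the result is the drift by `driftVelocity_center`. -/
theorem average_forcedShift (hc : Continuous M) (hT : 0 < T)
    (hp : Function.Periodic M T) (F : Fin s → ℝ) (k : Fin s) (τ : ℝ) (n : ℕ) :
    T⁻¹ * ∫ r in (τ + n * T)..(τ + n * T + T), forcedShift M F k r
      = (T⁻¹ * ∫ r in τ..(τ + T), forcedShift M F k r)
        + n * T * driftVelocity (centerMatrix M T * symplecticForm s * (centerMatrix M T)ᵀ) F k := by
  set w := symplecticForm s *ᵥ (F ᵥ* centerMatrix M T) with hw
  have h1 : ∀ r, forcedShift M F k (r + n * T)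
      = forcedShift M F k r + -(n * T) * ∑ j, M r (Sum.inl k) j * w j := fun r => by
    have h2 : ∑ j, M r (Sum.inl k) j * w j
        = ((M r * symplecticForm s) *ᵥ (F ᵥ* centerMatrix M T)) (Sum.inl k) := by
      rw [← Matrix.mulVec_mulVec]
      rfl
    have h3 : M (r + n * T) = M r := hp.nat_mul n r
    rw [h2, forcedShift, forcedShift, h3, forceIntegral_add_nat_mul hc hT hp, Matrix.mulVec_add,
      Matrix.mulVec_smul, Pi.add_apply, Pi.smul_apply, smul_eq_mul]
    ring
  have hcj : ∀ j, Continuous fun r => M r (Sum.inl k) j * w j := fun j =>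
    (hc.matrix_elem _ _).mul continuous_const
  have h4 : ∫ r in (τ + n * T)..(τ + n * T + T), forcedShift M F k r
      = ∫ r in τ..(τ + T), forcedShift M F k (r + n * T) := by
    rw [intervalIntegral.integral_comp_add_right (fun r => forcedShift M F k r), add_right_comm]
  have hcs : Continuous fun r => -(n * T) * ∑ j, M r (Sum.inl k) j * w j :=
    continuous_const.mul (continuous_finsetSum _ fun j _ => hcj j)
  rw [h4, driftVelocity_center, ← hw]
  simp only [h1]
  rw [intervalIntegral.integral_add ((continuous_forcedShift hc F k).intervalIntegrable _ _)
    (hcs.intervalIntegrable _ _),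
    intervalIntegral.integral_const_mul,
    intervalIntegral.integral_finsetSum fun j _ => (hcj j).intervalIntegrable _ _]
  simp only [intervalIntegral.integral_mul_const, integral_period hT hp, dotProduct, mul_assoc T,
    ← Finset.mul_sum]
  field_simp

end Integrals

variable {𝓗 : Type*} [NormedAddCommGroup 𝓗] [InnerProductSpace ℂ 𝓗]

theorem lie_center (Q : CanonicalObservables s 𝓗) (u : Matrix (Fin s) (Fin s ⊕ Fin s) ℝ)
    (k l : Fin s) : ⁅∑ i, (u k i : ℂ) • Q.q i, ∑ i, (u l i : ℂ) • Q.q i⁆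
      = (Complex.I * ((u * symplecticForm s * uᵀ) k l : ℂ)) • (1 : Module.End ℂ Q.domain) := by
  rw [lie_sum_smul]
  simp only [lie_smul_q, smul_smul, ← Finset.sum_smul, Matrix.mul_apply, Matrix.transpose_apply]
  congr 1
  push_cast
  rw [Finset.mul_sum]
  exact Finset.sum_congr rfl fun i _ => by ring

theorem dot_center (Q : CanonicalObservables s 𝓗) (u : Matrix (Fin s) (Fin s ⊕ Fin s) ℝ)
    (F : Fin s → ℝ) : Q.dot F (fun j => ∑ i, (u j i : ℂ) • Q.q i)
      = ∑ i, ((F ᵥ* u) i : ℂ) • Q.q i := by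
  simp only [dot, Finset.smul_sum, smul_smul, Matrix.vecMul, dotProduct, Complex.ofReal_sum,
    Complex.ofReal_mul, Finset.sum_smul]
  exact Finset.sum_comm

/-- The coefficient matrix `2 Ω h` of the Heisenberg equations of a quadratic Hamiltonian. -/
def heisenbergMatrix (h : ℝ → Matrix (Fin s ⊕ Fin s) (Fin s ⊕ Fin s) ℝ) (t : ℝ) :
    Matrix (Fin s ⊕ Fin s) (Fin s ⊕ Fin s) ℝ :=
  (2 : ℝ) • (symplecticForm s * h t)

theorem heisenbergMatrix_transpose_mul {h : ℝ → Matrix (Fin s ⊕ Fin s) (Fin s ⊕ Fin s) ℝ}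
    (hs : ∀ t, (h t).IsSymm) (t : ℝ) : (heisenbergMatrix h t)ᵀ * symplecticForm s
      = -(symplecticForm s * heisenbergMatrix h t) := by
  simp only [heisenbergMatrix, Matrix.transpose_smul, Matrix.transpose_mul,
    symplecticForm_transpose, (hs t).eq, Matrix.smul_mul, Matrix.mul_smul]
  rw [mul_assoc, neg_mul, symplecticForm_mul_self, ← mul_assoc, symplecticForm_mul_self]
  simp

theorem lie_forced_q (Q : CanonicalObservables s 𝓗)
    {h : ℝ → Matrix (Fin s ⊕ Fin s) (Fin s ⊕ Fin s) ℝ} (hs : ∀ t, (h t).IsSymm) (F : Fin s → ℝ)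
    (t : ℝ) (i : Fin s ⊕ Fin s) : Complex.I • ⁅Q.quadratic (h t) - Q.dot F Q.x, Q.q i⁆
      = ∑ j, (heisenbergMatrix h t i j : ℂ) • Q.q j
        + ((positionVector F ᵥ* symplecticForm s) i : ℂ) • (1 : Module.End ℂ Q.domain) := by
  have h1 : ⁅Q.quadratic (h t) - Q.dot F Q.x, Q.q i⁆
      = ⁅Q.quadratic (h t), Q.q i⁆ - ⁅Q.dot F Q.x, Q.q i⁆ := by
    simp only [Ring.lie_def, sub_mul, mul_sub]
    abel
  have h2 : ∀ c : ℂ, (-c) • (1 : Module.End ℂ Q.domain) = -(c • 1) := fun c =>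
    neg_smul c (1 : Module.End ℂ Q.domain)
  rw [h1, smul_sub, lie_quadratic_q Q (hs t), lie_dot_q, Complex.ofReal_neg, h2, sub_neg_eq_add]
  rfl

theorem coeff_eq_of_sum_smul_q_eq (Q : CanonicalObservables s 𝓗) [Nontrivial 𝓗]
    {a b : Fin s ⊕ Fin s → ℝ} (hab : ∑ i, (a i : ℂ) • Q.q i = ∑ i, (b i : ℂ) • Q.q i) : a = b := by
  have := Q.eq_zero_of_sum_smul_q (c := fun i => (a i : ℂ) - b i) (by
    have h1 : ∀ i, ((a i : ℂ) - b i) • Q.q i = (a i : ℂ) • Q.q i - (b i : ℂ) • Q.q i :=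
      fun i => sub_smul (a i : ℂ) (b i : ℂ) (Q.q i)
    simp only [h1, Finset.sum_sub_distrib, hab, sub_self])
  funext i
  exact_mod_cast sub_eq_zero.mp (congrFun this i)

namespace Evolution

variable {Q : CanonicalObservables s 𝓗} {H : ℝ → Module.End ℂ Q.domain} {B : Set ℝ}

theorem heisenberg_eq_of_U_eq_smul (E : Q.Evolution H B) {t r : ℝ} {c : ℂ}
    (hc : starRingEnd ℂ c * c = 1) (hU : ∀ ψ, E.U r 0 ψ = c • E.U t 0 ψ)
    (A : Module.End ℂ Q.domain) : E.heisenberg A r = E.heisenberg A t := by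
  refine Q.eq_of_inner fun φ ψ => ?_
  have : E.onDomain r 0 ψ = c • E.onDomain t 0 ψ := Subtype.ext (hU ψ)
  rw [inner_heisenberg, inner_heisenberg, this, hU, map_smul, Submodule.coe_smul, inner_smul_left,
    inner_smul_right, ← mul_assoc, hc, one_mul]

/-- For fixed `ψ` the vectors `q_i ψ` do not depend on time, so the vector integral reduces to
integrals of the coefficients. -/
theorem isTimeAverage_of_heisenberg_eq [CompleteSpace 𝓗] (E : Q.Evolution H B)
    {A : Module.End ℂ Q.domain} {a : ℝ → Fin s ⊕ Fin s → ℝ} {c : ℝ → ℝ}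
    (ha : ∀ i, Continuous fun t => a t i) (hc : Continuous c)
    (hA : ∀ t, E.heisenberg A t
      = ∑ i, (a t i : ℂ) • Q.q i + (c t : ℂ) • (1 : Module.End ℂ Q.domain)) (T τ : ℝ) :
    E.IsTimeAverage A T τ (∑ i, ((T⁻¹ * ∫ t in τ..(τ + T), a t i : ℝ) : ℂ) • Q.q i
      + ((T⁻¹ * ∫ t in τ..(τ + T), c t : ℝ) : ℂ) • (1 : Module.End ℂ Q.domain)) := by
  intro ψ
  have h1 : ∀ (b : Fin s ⊕ Fin s → ℝ) (d : ℝ), ((∑ i, (b i : ℂ) • Q.q i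
      + (d : ℂ) • (1 : Module.End ℂ Q.domain)) ψ : 𝓗)
      = ∑ i, b i • (Q.q i ψ : 𝓗) + d • (ψ : 𝓗) := fun b d => by
    simp only [LinearMap.add_apply, LinearMap.sum_apply, LinearMap.smul_apply, Submodule.coe_add,
      Submodule.coe_sum, Submodule.coe_smul, Module.End.one_apply]
    simp only [Complex.coe_smul]
  have hai : ∀ i, Continuous fun t => a t i • (Q.q i ψ : 𝓗) := fun i =>
    (ha i).smul continuous_const
  have hci : Continuous fun t => c t • (ψ : 𝓗) := hc.smul continuous_const
  have hsum : Continuous fun t => ∑ i, a t i • (Q.q i ψ : 𝓗) :=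
    continuous_finsetSum _ fun i _ => hai i
  simp only [hA, h1]
  refine ⟨(hsum.add hci).intervalIntegrable _ _, ?_⟩
  rw [intervalIntegral.integral_add (hsum.intervalIntegrable _ _) (hci.intervalIntegrable _ _),
    intervalIntegral.integral_finsetSum fun i _ => (hai i).intervalIntegrable _ _]
  simp only [intervalIntegral.integral_smul_const, smul_add, Finset.smul_sum, smul_smul]

/-- Closed trajectories mean that `U(T,0)` commutes with all `q_i`, so it is a number of modulus 1.
`U(t+T,t)` is its conjugate by `U(t,0)`, hence the same number. -/
theorem exists_phase_of_irreducible [Nontrivial 𝓗] (E : Q.Evolution H B) (hQ : Q.Irreducible)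
    {T : ℝ} (hT : ∀ i, E.heisenberg (Q.q i) T = Q.q i)
    (hU : ∀ t, E.U (t + T) 0 = E.U t 0 * E.U T 0) :
    ∃ χ : ℝ, ∀ (t : ℝ) (ψ : 𝓗), E.U (t + T) t ψ = Complex.exp (χ * Complex.I) • ψ := by
  obtain ⟨c, hc⟩ := hQ ((E.U T 0).toContinuousLinearEquiv : 𝓗 →L[ℂ] 𝓗) (E.U_mem T 0) fun i ψ => by
    have h1 : E.onDomain T 0 * Q.q i = Q.q i * E.onDomain T 0 := by
      conv_lhs => rw [← hT i, heisenberg, ← mul_assoc, ← mul_assoc, onDomain_mul, onDomain_self,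
        one_mul]
    exact congrArg Subtype.val (LinearMap.congr_fun h1 ψ)
  have hc' : ∀ ψ, E.U T 0 ψ = c • ψ := hc
  have hnorm : ‖c‖ = 1 := by
    obtain ⟨v, hv⟩ := exists_ne (0 : 𝓗)
    have h1 := (E.U T 0).norm_map v
    rw [hc', norm_smul] at h1
    exact mul_right_cancel₀ (norm_ne_zero_iff.mpr hv) (h1.trans (one_mul _).symm)
  refine ⟨c.arg, fun t ψ => ?_⟩
  have h2 : Complex.exp (c.arg * Complex.I) = c := by
    simpa [hnorm] using Complex.norm_mul_exp_arg_mul_I c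
  have h3 : E.U t 0 (E.U 0 t ψ) = ψ := by
    change (E.U t 0 * E.U 0 t) ψ = ψ
    rw [E.U_mul, E.U_self]
    rfl
  rw [h2, ← E.U_mul (t + T) 0 t, hU]
  change E.U t 0 (E.U T 0 (E.U 0 t ψ)) = _
  rw [hc', map_smul, h3]

end Evolution

end CanonicalObservables

/-! ### Trajectories in a constant force -/

namespace CanonicalObservables

namespace Evolution

variable {s : ℕ} {𝓗 : Type*} [NormedAddCommGroup 𝓗] [InnerProductSpace ℂ 𝓗]
  {Q : CanonicalObservables s 𝓗} {h : ℝ → Matrix (Fin s ⊕ Fin s) (Fin s ⊕ Fin s) ℝ}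
  {M : ℝ → Matrix (Fin s ⊕ Fin s) (Fin s ⊕ Fin s) ℝ} {F : Fin s → ℝ} {T : ℝ}
  {H : ℝ → Module.End ℂ Q.domain} {B : Set ℝ}

/-- The trajectories of the canonical observables in a constant force `F`, in terms of the
fundamental matrix `M` of the motion without the force. -/
def HasForcedTrajectory (E : Q.Evolution H B)
    (M : ℝ → Matrix (Fin s ⊕ Fin s) (Fin s ⊕ Fin s) ℝ) (F : Fin s → ℝ) : Prop :=
  ∀ t i, E.heisenberg (Q.q i) t = ∑ j, (M t i j : ℂ) • Q.q j
    + ((-((M t * symplecticForm s) *ᵥ forceIntegral M F t) i : ℝ) : ℂ)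
      • (1 : Module.End ℂ Q.domain)

theorem hasForcedTrajectory
    (E : Q.Evolution (fun t => Q.quadratic (h t) - Q.dot F Q.x) B) (hB : B.Countable)
    (hs : ∀ t, (h t).IsSymm) (hM : IsFundamentalMatrix (heisenbergMatrix h) B M) :
    E.HasForcedTrajectory M F := fun t i => by
  rw [E.heisenberg_q hB (fun t => (Q.quadratic_symm (hs t)).sub (Q.dot_symm F))
    (heisenbergMatrix_transpose_mul hs) (Q.lie_forced_q hs F) hM t i, sub_eq_add_neg,
    Complex.ofReal_neg]
  congr 1
  exact (neg_smul _ (1 : Module.End ℂ Q.domain)).symm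

theorem heisenberg_q_eq_sum (E : Q.Evolution (fun t => Q.quadratic (h t)) B) (hB : B.Countable)
    (hs : ∀ t, (h t).IsSymm) (hM : IsFundamentalMatrix (heisenbergMatrix h) B M)
    (t : ℝ) (i : Fin s ⊕ Fin s) : E.heisenberg (Q.q i) t = ∑ j, (M t i j : ℂ) • Q.q j := by
  have h0 : Q.dot (0 : Fin s → ℝ) Q.x = 0 := by simp [dot]
  have h1 := Q.lie_forced_q hs 0
  simp only [h0, sub_zero] at h1
  rw [E.heisenberg_q hB (fun t => Q.quadratic_symm (hs t))
    (heisenbergMatrix_transpose_mul hs) h1 hM t i]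
  have h2 : (fun k => ∫ r in (0 : ℝ)..t, (positionVector (0 : Fin s → ℝ) ᵥ* M r) k) = 0 := by
    ext k
    simp [positionVector_zero]
  rw [h2, Matrix.mulVec_zero, Pi.zero_apply, Complex.ofReal_zero]
  refine (congrArg _ (zero_smul ℂ (1 : Module.End ℂ Q.domain))).trans ?_
  rw [sub_zero]

theorem exists_heisenbergMatrix_fundamental [Nontrivial 𝓗]
    (E : Q.Evolution (fun t => Q.quadratic (h t)) B) (hs : ∀ t, (h t).IsSymm) :
    ∃ M, IsFundamentalMatrix (heisenbergMatrix h) B M := by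
  have h0 : Q.dot (0 : Fin s → ℝ) Q.x = 0 := by simp [dot]
  have h1 := Q.lie_forced_q hs 0
  simp only [h0, sub_zero, positionVector_zero, Matrix.zero_vecMul] at h1
  exact E.exists_isFundamentalMatrix fun φ ψ =>
    (E.isLinearSolution (fun t => Q.quadratic_symm (hs t)) h1 φ ψ).of_homogeneous

/-- The loop phase drops out of `U† q U`, so `q(t)` is periodic, and its coefficients are unique. -/
theorem fundamentalMatrix_periodic [Nontrivial 𝓗]
    (E : Q.Evolution (fun t => Q.quadratic (h t)) B) (hB : B.Countable)
    (hs : ∀ t, (h t).IsSymm) (hp : Function.Periodic h T) (hBT : ∀ t, t + T ∈ B → t ∈ B)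
    (h_loop : ∃ φ : ℝ, ∀ ψ : 𝓗, E.U T 0 ψ = Complex.exp (φ * Complex.I) • ψ)
    (hM : IsFundamentalMatrix (heisenbergMatrix h) B M) : Function.Periodic M T := fun t => by
  obtain ⟨φ, hφ⟩ := h_loop
  have h1 : ∀ i, E.heisenberg (Q.q i) (t + T) = E.heisenberg (Q.q i) t := fun i => by
    refine E.heisenberg_eq_of_U_eq_smul (c := Complex.exp (φ * Complex.I)) ?_ ?_ _
    · rw [← Complex.normSq_eq_conj_mul_self, Complex.normSq_eq_norm_sq,
        Complex.norm_exp_ofReal_mul_I]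
      simp
    · intro ψ
      rw [E.U_add_period_zero hB (fun t => Q.quadratic_symm (hs t)) (fun r => by rw [hp r]) hBT t]
      change E.U t 0 (E.U T 0 ψ) = _
      rw [hφ, map_smul]
  ext i j
  have h2 := h1 i
  rw [E.heisenberg_q_eq_sum hB hs hM, E.heisenberg_q_eq_sum hB hs hM] at h2
  exact congrFun (Q.coeff_eq_of_sum_smul_q_eq h2) j

namespace HasForcedTrajectory

variable {E : Q.Evolution H B}

theorem heisenberg_nat_mul (hE : E.HasForcedTrajectory M F) (hc : Continuous M) (hT : 0 < T)
    (hp : Function.Periodic M T) (h0 : M 0 = 1) (n : ℕ) (i : Fin s ⊕ Fin s) :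
    E.heisenberg (Q.q i) (n * T) = Q.q i
      + ((-(n * T * (symplecticForm s *ᵥ (F ᵥ* centerMatrix M T)) i) : ℝ) : ℂ)
        • (1 : Module.End ℂ Q.domain) := by
  have h1 : M (n * T) = 1 := by
    have := hp.nat_mul n 0
    rwa [zero_add, h0] at this
  have h2 : forceIntegral M F (n * T) = (n * T) • (F ᵥ* centerMatrix M T) := by
    have := forceIntegral_add_nat_mul hc hT hp F 0 n
    have h3 : forceIntegral M F 0 = 0 := by ext k; simp [forceIntegral]
    rwa [zero_add, h3, zero_add] at this
  rw [hE, h1, h2, one_mul, Matrix.mulVec_smul]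
  congr 1
  simp [Matrix.one_apply, apply_ite Complex.ofReal]

theorem displacement (hE : E.HasForcedTrajectory M F) (hc : Continuous M) (hT : 0 < T)
    (hp : Function.Periodic M T) (h0 : M 0 = 1) (n : ℕ) (i : Fin s ⊕ Fin s) :
    E.heisenberg (Q.q i) (n * T) = Q.q i - (Complex.I * ((n * T : ℝ) : ℂ)) •
      ⁅Q.dot F (fun j => ∑ i, (centerMatrix M T j i : ℂ) • Q.q i), Q.q i⁆ := by
  rw [hE.heisenberg_nat_mul hc hT hp h0, dot_center, lie_smul_q, smul_smul, sub_eq_add_neg]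
  congr 1
  refine Eq.trans ?_ (neg_smul _ (1 : Module.End ℂ Q.domain))
  congr 1
  simp only [Matrix.mulVec, dotProduct]
  push_cast
  have h1 : ∀ j, (symplecticForm s i j : ℂ) = -(symplecticForm s j i : ℂ) := fun j => by
    exact_mod_cast symplecticForm_swap i j
  simp only [h1, neg_mul, Finset.sum_neg_distrib, mul_comm (symplecticForm s _ i : ℂ)]
  linear_combination ((n * T : ℂ)
    * ∑ j, ((F ᵥ* centerMatrix M T) j : ℂ) * (symplecticForm s j i : ℂ)) * Complex.I_mul_I

theorem heisenberg_center (hE : E.HasForcedTrajectory M F) (hc : Continuous M) (hT : 0 < T)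
    (hp : Function.Periodic M T) (h0 : M 0 = 1) (n : ℕ) (k : Fin s) :
    E.heisenberg (∑ i, (centerMatrix M T k i : ℂ) • Q.q i) (n * T)
      = ∑ i, (centerMatrix M T k i : ℂ) • Q.q i
        + ((n * T * driftVelocity (centerMatrix M T * symplecticForm s * (centerMatrix M T)ᵀ) F k
          : ℝ) : ℂ) • (1 : Module.End ℂ Q.domain) := by
  rw [heisenberg_sum, driftVelocity_center]
  simp only [heisenberg_smul, hE.heisenberg_nat_mul hc hT hp h0, smul_add, Finset.sum_add_distrib,
    smul_smul, ← Finset.sum_smul]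
  congr 2
  simp only [dotProduct]
  push_cast
  rw [← Finset.sum_neg_distrib, Finset.mul_sum]
  exact Finset.sum_congr rfl fun i _ => by ring

theorem isTimeAverage [CompleteSpace 𝓗] (hE : E.HasForcedTrajectory M F) (hc : Continuous M)
    (hT : 0 < T) (hp : Function.Periodic M T) (τ : ℝ) (k : Fin s) :
    E.IsTimeAverage (Q.x k) T τ (∑ i, (centerMatrix M T k i : ℂ) • Q.q i
      + ((T⁻¹ * ∫ r in τ..(τ + T), forcedShift M F k r : ℝ) : ℂ)
        • (1 : Module.End ℂ Q.domain)) := by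
  have := E.isTimeAverage_of_heisenberg_eq (A := Q.x k) (fun i => hc.matrix_elem (Sum.inl k) i)
    (continuous_forcedShift hc F k) (fun t => hE t (Sum.inl k)) T τ
  simpa only [integral_period hT hp, inv_mul_cancel_left₀ hT.ne'] using this

theorem heisenberg_add_period (hE : E.HasForcedTrajectory M F) (hc : Continuous M) (hT : 0 < T)
    (hp : Function.Periodic M T) (hu : centerMatrix M T = 0) (t : ℝ) (i : Fin s ⊕ Fin s) :
    E.heisenberg (Q.q i) (t + T) = E.heisenberg (Q.q i) t := by
  have h1 := forceIntegral_add_nat_mul hc hT hp F t 1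
  rw [Nat.cast_one, one_mul, hu, Matrix.vecMul_zero, smul_zero, add_zero] at h1
  rw [hE, hE, hp t, h1]

/-- A nonzero force deforms the trajectories already within any initial interval of time. -/
theorem exists_ne [Nontrivial 𝓗] {H₀ : ℝ → Module.End ℂ Q.domain} {E₀ : Q.Evolution H₀ B}
    (hE : E.HasForcedTrajectory M F)
    (hE₀ : ∀ t i, E₀.heisenberg (Q.q i) t = ∑ j, (M t i j : ℂ) • Q.q j) (hc : Continuous M)
    (hinv : ∀ t, IsUnit (M t)) (hT : 0 < T) (hF : F ≠ 0) :
    ∃ t ∈ Set.Ioo 0 T, ∃ i, E.heisenberg (Q.q i) t ≠ E₀.heisenberg (Q.q i) t := by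
  by_contra! hall
  have hG : ∀ t ∈ Set.Ioo 0 T, forceIntegral M F t = 0 := fun t ht => by
    have h1 : (M t * symplecticForm s) *ᵥ forceIntegral M F t = 0 := by
      ext i
      have h2 := hall t ht i
      rw [hE, hE₀, add_eq_left] at h2
      have h3 := Q.smul_one_injective h2
      exact neg_eq_zero.mp (by exact_mod_cast h3)
    have hΩ : IsUnit (symplecticForm s) := IsUnit.of_mul_eq_one (-symplecticForm s) (by
      rw [mul_neg, symplecticForm_mul_self, neg_neg])
    exact Matrix.mulVec_injective_of_isUnit ((hinv t).mul hΩ) (h1.trans (Matrix.mulVec_zero _).symm)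
  -- At an interior time the vanishing of the force integral can be differentiated.
  have hmid : T / 2 ∈ Set.Ioo 0 T := ⟨by linarith, by linarith⟩
  have hder : positionVector F ᵥ* M (T / 2) = 0 := by
    ext k
    refine (hasDerivAt_forceIntegral hc F (T / 2) k).unique
      ((hasDerivAt_const (T / 2) (0 : ℝ)).congr_of_eventuallyEq ?_)
    filter_upwards [isOpen_Ioo.mem_nhds hmid] with t ht
    rw [hG t ht]
    rfl
  have hz : positionVector F = 0 :=
    Matrix.vecMul_injective_of_isUnit (hinv (T / 2)) (hder.trans (Matrix.zero_vecMul _).symm)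
  exact hF (funext fun k => congrFun hz (Sum.inl k))

end HasForcedTrajectory

end Evolution

end CanonicalObservables

/-! ### The proposition -/

theorem proposition1 {s : ℕ} {𝓗 : Type*} [NormedAddCommGroup 𝓗] [InnerProductSpace ℂ 𝓗]
    [CompleteSpace 𝓗] [Nontrivial 𝓗] (Q : CanonicalObservables s 𝓗)
    (h : ℝ → Matrix (Fin s ⊕ Fin s) (Fin s ⊕ Fin s) ℝ)
    (h_symm : ∀ t, (h t).IsSymm) (h_cont : IsPiecewiseContinuous h)
    (T : ℝ) (hT : 0 < T) (h_per : Function.Periodic h T)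
    -- the evolution of the quadratic Hamiltonian, which is a loop on `[0, T]`
    (E : Q.Evolution (fun t => Q.quadratic (h t)) (jumpTimes h))
    (h_loop : ∃ φ : ℝ, ∀ ψ : 𝓗, E.U T 0 ψ = Complex.exp (φ * Complex.I) • ψ) :
    -- the loop center `X` exists, does not depend on the period over which the average is taken,
    -- is linear in the canonical observables, and has numerical commutators
    ∃ (X : Fin s → Module.End ℂ Q.domain) (κ : Matrix (Fin s) (Fin s) ℝ),
      (∀ (j : Fin s) (τ : ℝ), E.IsTimeAverage (Q.x j) T τ (X j)) ∧
      (∃ u : Matrix (Fin s) (Fin s ⊕ Fin s) ℝ, ∀ j, X j = ∑ i, (u j i : ℂ) • Q.q i) ∧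
      (∀ k l, ⁅X k, X l⁆ = (Complex.I * (κ k l : ℂ)) • (1 : Module.End ℂ Q.domain)) ∧
      -- a fuzzy center is moved by some force
      ((∃ k l, ⁅X k, X l⁆ ≠ 0) → ∃ F : Fin s → ℝ, driftVelocity κ F ≠ 0) ∧
      -- for every constant force `F`, and the evolution under `H(t) - F · x`:
      ∀ (F : Fin s → ℝ)
        (E' : Q.Evolution (fun t => Q.quadratic (h t) - Q.dot F Q.x) (jumpTimes h)),
        -- the displacement of the canonical observables after `n` periods depends on `X` only
        (∀ (n : ℕ) (i : Fin s ⊕ Fin s), E'.heisenberg (Q.q i) (n * T)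
          = Q.q i - (Complex.I * ((n * T : ℝ) : ℂ)) • ⁅Q.dot F X, Q.q i⁆) ∧
        -- the center observable drifts with the constant velocity `v`, orthogonal to `F`
        (∀ (n : ℕ) (k : Fin s), E'.heisenberg (X k) (n * T)
          = X k + ((n * T * driftVelocity κ F k : ℝ) : ℂ) • (1 : Module.End ℂ Q.domain)) ∧
        F ⬝ᵥ driftVelocity κ F = 0 ∧
        -- so does the time average of the perturbed trajectory over one period
        (∃ Y : ℝ → Fin s → Module.End ℂ Q.domain,
          (∀ (τ : ℝ) (k : Fin s), E'.IsTimeAverage (Q.x k) T τ (Y τ k)) ∧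
          (∀ (τ : ℝ) (n : ℕ) (k : Fin s), Y (τ + n * T) k = Y τ k +
            ((n * T * driftVelocity κ F k : ℝ) : ℂ) • (1 : Module.End ℂ Q.domain)) ∧
          -- if the coordinates of the center commute, the center does not drift
          ((∀ k l, ⁅X k, X l⁆ = 0) →
            (∀ (n : ℕ) (k : Fin s), E'.heisenberg (X k) (n * T) = X k) ∧
            ∀ (τ : ℝ) (n : ℕ) (k : Fin s), Y (τ + n * T) k = Y τ k)) ∧
        -- if the center vanishes, the perturbed trajectory is a deformed, but still closed loop
        ((∀ k, X k = 0) →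
          (∀ (t : ℝ) (i : Fin s ⊕ Fin s),
            E'.heisenberg (Q.q i) (t + T) = E'.heisenberg (Q.q i) t) ∧
          (Q.Irreducible → ∃ χ : ℝ, ∀ (t : ℝ) (ψ : 𝓗),
            E'.U (t + T) t ψ = Complex.exp (χ * Complex.I) • ψ) ∧
          (F ≠ 0 → ∃ t ∈ Set.Ioo 0 T, ∃ i : Fin s ⊕ Fin s,
            E'.heisenberg (Q.q i) t ≠ E.heisenberg (Q.q i) t)) := by
  have hB := jumpTimes_countable h_cont
  have hBT : ∀ t, t + T ∈ jumpTimes h → t ∈ jumpTimes h := fun t => (add_mem_jumpTimes h_per).mp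
  obtain ⟨M, hM⟩ := E.exists_heisenbergMatrix_fundamental h_symm
  have hc := hM.continuous
  have hp := E.fundamentalMatrix_periodic hB h_symm h_per hBT h_loop hM
  have hq := E.heisenberg_q_eq_sum hB h_symm hM
  set u := CanonicalObservables.centerMatrix M T with hu
  have hlie := Q.lie_center u
  have hcomm : ∀ {k l : Fin s}, ⁅∑ i, (u k i : ℂ) • Q.q i, ∑ i, (u l i : ℂ) • Q.q i⁆ = 0 ↔
      (u * symplecticForm s * uᵀ) k l = 0 := fun {k l} => by
    rw [hlie]
    refine ⟨fun h0 => ?_, fun h0 => ?_⟩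
    · simpa using Q.smul_one_injective h0
    · rw [h0, Complex.ofReal_zero, mul_zero]
      exact zero_smul ℂ (1 : Module.End ℂ Q.domain)
  -- The loop itself is the case of zero force, so the time averages with and without force come
  -- from one lemma.
  have hE : E.HasForcedTrajectory M 0 := fun t i => by
    have h0 : CanonicalObservables.forceIntegral M 0 t = 0 := by
      ext k
      simp [CanonicalObservables.forceIntegral, CanonicalObservables.positionVector_zero]
    rw [hq, h0, Matrix.mulVec_zero, Pi.zero_apply, neg_zero, Complex.ofReal_zero]
    refine (add_zero _).symm.trans (congrArg _ (zero_smul ℂ (1 : Module.End ℂ Q.domain)).symm)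
  refine ⟨fun j => ∑ i, (u j i : ℂ) • Q.q i, u * symplecticForm s * uᵀ, fun j τ => ?_,
    ⟨u, fun j => rfl⟩, hlie, ?_, fun F E' => ?_⟩
  · have h0 : ∀ r, CanonicalObservables.forcedShift M 0 j r = 0 := fun r => by
      have : CanonicalObservables.forceIntegral M 0 r = 0 := by
        ext k
        simp [CanonicalObservables.forceIntegral, CanonicalObservables.positionVector_zero]
      rw [CanonicalObservables.forcedShift, this, Matrix.mulVec_zero, Pi.zero_apply, neg_zero]
    have h1 := hE.isTimeAverage hc hT hp τ j
    simp only [h0, intervalIntegral.integral_zero, mul_zero, Complex.ofReal_zero] at h1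
    convert h1 using 1
    exact (add_zero _).symm.trans (congrArg _ (zero_smul ℂ (1 : Module.End ℂ Q.domain)).symm)
  · rintro ⟨k, l, hkl⟩
    -- A unit force along `k` has drift velocity `κ k l` in direction `l`.
    refine ⟨Pi.single k 1, fun hv => hkl (hcomm.mpr ?_)⟩
    simpa [driftVelocity, Pi.single_apply] using congrFun hv l
  have hE' := E'.hasForcedTrajectory hB h_symm hM
  have hdrift : (∀ k l, ⁅∑ i, (u k i : ℂ) • Q.q i, ∑ i, (u l i : ℂ) • Q.q i⁆ = 0) →
      ∀ (n : ℕ) (k : Fin s) (A : Module.End ℂ Q.domain),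
        A + ((n * T * driftVelocity (u * symplecticForm s * uᵀ) F k : ℝ) : ℂ)
          • (1 : Module.End ℂ Q.domain) = A := fun h0 n k A => by
    have hv : driftVelocity (u * symplecticForm s * uᵀ) F k = 0 :=
      Finset.sum_eq_zero fun l _ => by rw [hcomm.mp (h0 l k), zero_mul]
    rw [hv, mul_zero, Complex.ofReal_zero]
    exact (congrArg _ (zero_smul ℂ (1 : Module.End ℂ Q.domain))).trans (add_zero _)
  have hY : ∀ (τ : ℝ) (n : ℕ) (k : Fin s), ∑ i, (u k i : ℂ) • Q.q i
      + ((T⁻¹ * ∫ r in (τ + n * T)..(τ + n * T + T),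
        CanonicalObservables.forcedShift M F k r : ℝ) : ℂ) • (1 : Module.End ℂ Q.domain)
      = ∑ i, (u k i : ℂ) • Q.q i + ((T⁻¹ * ∫ r in τ..(τ + T),
          CanonicalObservables.forcedShift M F k r : ℝ) : ℂ) • (1 : Module.End ℂ Q.domain)
        + ((n * T * driftVelocity (u * symplecticForm s * uᵀ) F k : ℝ) : ℂ)
          • (1 : Module.End ℂ Q.domain) := fun τ n k => by
    rw [CanonicalObservables.average_forcedShift hc hT hp, Complex.ofReal_add, add_assoc]
    exact congrArg _ (add_smul _ _ (1 : Module.End ℂ Q.domain))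
  have hX := hE'.heisenberg_center hc hT hp hM.zero
  refine ⟨hE'.displacement hc hT hp hM.zero, hX, CanonicalObservables.dotProduct_driftVelocity
      (CanonicalObservables.center_form_transpose u) F,
    ⟨fun τ k => ∑ i, (u k i : ℂ) • Q.q i
      + ((T⁻¹ * ∫ r in τ..(τ + T), CanonicalObservables.forcedShift M F k r : ℝ) : ℂ)
        • (1 : Module.End ℂ Q.domain), hE'.isTimeAverage hc hT hp, hY, fun h0 =>
        ⟨fun n k => (hX n k).trans (hdrift h0 n k _),
          fun τ n k => (hY τ n k).trans (hdrift h0 n k _)⟩⟩, fun h0 => ?_⟩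
  -- Linear independence of the `q_i` turns `X = 0` into the vanishing of its coefficients.
  have hu0 : u = 0 := by
    ext k i
    have h1 : ∑ i, (u k i : ℂ) • Q.q i = ∑ i, (((0 : Fin s ⊕ Fin s → ℝ) i : ℝ) : ℂ) • Q.q i := by
      exact (h0 k).trans (Finset.sum_eq_zero fun i _ => zero_smul ℂ (Q.q i)).symm
    exact congrFun (Q.coeff_eq_of_sum_smul_q_eq h1) i
  have hper := hE'.heisenberg_add_period hc hT hp hu0
  refine ⟨hper, fun hirr => E'.exists_phase_of_irreducible hirr (fun i => ?_)
    (E'.U_add_period_zero hB (fun t => (Q.quadratic_symm (h_symm t)).sub (Q.dot_symm F))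
      (fun r => by simp only [h_per r]) hBT), fun hF => hE'.exists_ne hq hc (fun t => ?_) hT hF⟩
  · have := hper 0 i
    rwa [zero_add, E'.heisenberg_zero_time] at this
  · exact IsUnit.of_mul_eq_one _
      (hM.mul_inverse hB (CanonicalObservables.heisenbergMatrix_transpose_mul h_symm) t)
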